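/- Let $G$ be a countable discrete abelian group. Let $F$ assign to every $N\in\mathbb{N}_0=\{0,1,2,\dots\}$ an operation $$F(N)=(\gamma_N,\,s(N,0),\dots,s(N,\gamma_N-1),\,g(N,0),\dots,g(N,\gamma_N-1)),$$ where $\gamma_N>1$ is an integer, $s(N,i)\in\mathbb{N}_0$ and $g(N,i)\in G$. Assume that $F$ is recurrent: for all $n,d\in\mathbb{N}_0$ there are infinitely many $m$ with $F(n+i)=F(m+i)$ for all $0\le i<d$. Construct columns (finite sequences of intervals of equal length, called levels) as follows. For each $a\in G$ the column $C_{0,a}$ is a single interval of length $1$ (these intervals being pairwise disjoint). Given the columns $C_{N,a}$ ($a\in G$), all of height $h_N$, cut every level into $\gamma_N$ subintervals of equal length, numbered $0,\dots,\gamma_N-1$. The column $C_{N+1,a}$ is obtained by stacking, for $i=0,1,\dots,\gamma_N-1$ in this order from bottom to top, the $i$-th subintervals of the levels of $C_{N,a+g(N,i)}$ (in their order in that column) followed by $s(N,i)$ new disjoint intervals (spacers) of the same length. Thus $h_0=1$ and $h_{N+1}=\gamma_N h_N+\sum_{i=0}^{\gamma_N-1}s(N,i)$. Let $X$ be the union of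 all levels with Lebesgue measure $\mu$, and let $T$ be the (a.e. defined, invertible, measure-preserving) transformation of $X$ that maps every level of every column, except the top one, by translation onto the level directly above it. A transformation $S$ of a measure space $(Y,\nu)$ is ergodic if for all measurable $A,B$ of positive measure there is $i\ge 0$ with $\nu(S^{-i}A\cap B)>0$. $T$ is totally ergodic if $T^n$ is ergodic for every $n\ge 1$, and power weakly mixing if $T^{k_1}\times\cdots\times T^{k_d}$ is ergodic on $(X^d,\mu^d)$ for all $d\ge1$ and all nonzero integers $k_1,\dots,k_d$. In $\mathbb{Z}\times G$ put $$t_{N,i}=\bigl(s(N,i)+h_N,\ g(N,i+1)-g(N,i)\bigr)\qquad(0\le i\le\gamma_N-2),$$ $$c_{M,i}=\bigl(s(M+1,i)+s(M,\gamma_M-1)-s(M,0),\ g(M+1,i+1)-g(M+1,i)+2g(M,0)-g(M,\gamma_M-1)-g(M,1)\bigr)\qquad(0\le i\le\gamma_{M+1}-2),$$ and consider the conditions 1. $\{g(N,i)-g(N,0): N\in\mathbb{N}_0,\ 0\le i\le\gamma_N-1\}$ generates $G$; 2. for every $N\in\mathbb{N}_0$, $(1,0)$ lies in the integer span of $\{t_{N,i}:0\le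 i\le\gamma_N-2\}\cup\{c_{M,i}:M\in\mathbb{N}_0,\ 0\le i\le\gamma_{M+1}-2\}$. Then: (a) $T$ is power weakly mixing if and only if conditions 1 and 2 both hold; (b) $T$ is power weakly mixing if and only if $T$ is totally ergodic; (c) $T$ is ergodic if and only if condition 1 holds. -/

import Mathlib

open MeasureTheory

noncomputable section

/-- One cutting-and-stacking operation: the number `cuts > 1` of pieces into which every level is
cut, the number of spacers put above each piece, and the change of column index of each piece. -/
@[ext]
structure CutOp (G : Type*) where
  cuts : ℕ
  one_lt_cuts : 1 < cuts
  spacers : Fin cuts → ℕ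
  shifts : Fin cuts → G

namespace CutStack

variable {G : Type*} [AddCommGroup G]

/-- Every finite string of operations that occurs in `F` occurs infinitely often. -/
def Recurrent (F : ℕ → CutOp G) : Prop :=
  ∀ n d : ℕ, {m : ℕ | ∀ i < d, F (n + i) = F (m + i)}.Infinite

/-- The number `γ_N` of pieces into which the levels of generation `N` are cut. -/
def γ (F : ℕ → CutOp G) (N : ℕ) : ℕ := (F N).cuts

/-- The number `s(N, i)` of spacers; only used for `i < γ_N`. -/
def s (F : ℕ → CutOp G) (N i : ℕ) : ℕ :=
  if h : i < (F N).cuts then (F N).spacers ⟨i, h⟩ else 0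

/-- The change of column index `g(N, i)`; only used for `i < γ_N`. -/
def g (F : ℕ → CutOp G) (N i : ℕ) : G :=
  if h : i < (F N).cuts then (F N).shifts ⟨i, h⟩ else 0

/-- The common height `h_N` of the columns of generation `N`. -/
def height (F : ℕ → CutOp G) : ℕ → ℕ
  | 0 => 1
  | N + 1 => γ F N * height F N + ∑ i ∈ Finset.range (γ F N), s F N i

/-- The common length of the levels of generation `N`. -/
def width (F : ℕ → CutOp G) : ℕ → ℝ
  | 0 => 1
  | N + 1 => width F N / γ F N

/-- The column `C_{N,a}`, as the list of its levels from bottom to top. All intervals lie in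
`ℝ × G`, a disjoint union of copies of the line indexed by `G`; an entry `(t, b)` of the list
stands for the interval `[t, t + width N) × {b}`, see `level`.
`C_{N+1,a}` stacks, for `i = 0, …, γ_N - 1` in turn, the `i`-th pieces of the levels of
`C_{N, a + g(N,i)}` and then `s(N,i)` spacers. The generation-`N` intervals fill
`[0, h_N * width N) × G`; the new spacers of `C_{N+1,a}` are laid side by side directly to the right
of that in the copy of the line with index `a`. -/
def column (F : ℕ → CutOp G) : ℕ → G → List (ℝ × G)
  | 0, a => [(0, a)]
  | N + 1, a => (List.range (γ F N)).flatMap fun (i : ℕ) =>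
      (column F N (a + g F N i)).map (fun p => (p.1 + i * width F (N + 1), p.2)) ++
      (List.range (s F N i)).map (fun (j : ℕ) =>
        (height F N * width F N
          + ((∑ k ∈ Finset.range i, s F N k : ℕ) + j) * width F (N + 1), a))

/-- The interval of generation `N` given by an entry of a column. -/
def level (F : ℕ → CutOp G) (N : ℕ) (p : ℝ × G) : Set (ℝ × G) :=
  Set.Ico p.1 (p.1 + width F N) ×ˢ {p.2}

/-- The union of all levels of all columns: the space on which the transformation lives. -/
def space (F : ℕ → CutOp G) : Set (ℝ × G) :=
  {x | ∃ N a, ∃ p ∈ column F N a, x ∈ level F N p}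

/-- The invariant measure: Lebesgue measure on every copy of the line, restricted to the space. -/
def μ [MeasurableSpace G] (F : ℕ → CutOp G) : Measure (ℝ × G) :=
  ((volume : Measure ℝ).prod (Measure.count : Measure G)).restrict (space F)

/-- `y` is the point directly above `x` in some column: `q` is the level that follows the level
`p` of that column, and `y ∈ q` is the image of `x ∈ p` under the translation from `p` to `q`. -/
def Above (F : ℕ → CutOp G) (x y : ℝ × G) : Prop :=
  ∃ N a p q, [p, q] <:+: column F N a ∧ x ∈ level F N p ∧ y = (x.1 + (q.1 - p.1), q.2)

open Classical in
/-- The transformation: it sends a point to the point directly above it. (The point above is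
unique; points without one form a null set of the space and are fixed.) -/
def T (F : ℕ → CutOp G) (x : ℝ × G) : ℝ × G :=
  if h : ∃ y, Above F x y then h.choose else x

open Classical in
/-- The inverse transformation (up to a null set): it sends a point to the point directly below
it. -/
def Tinv (F : ℕ → CutOp G) (y : ℝ × G) : ℝ × G :=
  if h : ∃ x, Above F x y then h.choose else y

/-- The integer powers of the transformation. -/
def Tpow (F : ℕ → CutOp G) : ℤ → ℝ × G → ℝ × G
  | Int.ofNat n => (T F)^[n]
  | Int.negSucc n => (Tinv F)^[n + 1]

/-- Ergodicity: for any two sets of positive measure some `f^{-i} A`, `i ≥ 0`, meets `B` in a set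
of positive measure. -/
def IsErgodic {Y : Type*} [MeasurableSpace Y] (ν : Measure Y) (f : Y → Y) : Prop :=
  ∀ A B : Set Y, MeasurableSet A → MeasurableSet B → 0 < ν A → 0 < ν B →
    ∃ i : ℕ, 0 < ν ((f^[i]) ⁻¹' A ∩ B)

/-- All positive powers of the transformation are ergodic. -/
def TotallyErgodic [MeasurableSpace G] (F : ℕ → CutOp G) : Prop :=
  ∀ n : ℕ, 0 < n → IsErgodic (μ F) (T F)^[n]

/-- `T^{k_1} × ⋯ × T^{k_d}` is ergodic for all nonzero integers `k_1, …, k_d`, `d > 0`. -/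
def PowerWeaklyMixing [MeasurableSpace G] (F : ℕ → CutOp G) : Prop :=
  ∀ (d : ℕ) (k : Fin d → ℤ), 0 < d → (∀ i, k i ≠ 0) →
    IsErgodic (Measure.pi fun _ : Fin d => μ F) (fun x i => Tpow F (k i) (x i))

/-- The vector `t_{N,i}`. -/
def t (F : ℕ → CutOp G) (N i : ℕ) : ℤ × G :=
  ((s F N i : ℤ) + height F N, g F N (i + 1) - g F N i)

/-- The vector `c_{M,i}`. -/
def c (F : ℕ → CutOp G) (M i : ℕ) : ℤ × G :=
  ((s F (M + 1) i : ℤ) + s F M (γ F M - 1) - s F M 0,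
    g F (M + 1) (i + 1) - g F (M + 1) i + (2 : ℕ) • g F M 0 - g F M (γ F M - 1) - g F M 1)

/-- The differences `g(N,i) - g(N,0)` generate `G`. -/
def ShiftsGenerate (F : ℕ → CutOp G) : Prop :=
  AddSubgroup.closure {x : G | ∃ N i, i < γ F N ∧ x = g F N i - g F N 0} = ⊤

/-- For every `N`, `(1,0)` is in the integer span of the `t_{N,i}`, `0 ≤ i ≤ γ_N - 2`, and the
`c_{M,i}`, `M ≥ 0`, `0 ≤ i ≤ γ_{M+1} - 2`. -/
def SpanCondition (F : ℕ → CutOp G) : Prop :=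
  ∀ N : ℕ, ((1, 0) : ℤ × G) ∈ AddSubgroup.closure
    ({v | ∃ i, i + 2 ≤ γ F N ∧ v = t F N i} ∪
      {v | ∃ M i, i + 2 ≤ γ F (M + 1) ∧ v = c F M i})

/-- The columns `C_{N,a}` have `h_N` levels. -/
theorem length_column (F : ℕ → CutOp G) (N : ℕ) (a : G) :
    (column F N a).length = height F N := by
  induction N generalizing a with
  | zero => rfl
  | succ N ih =>
    simp only [column, height, List.length_flatMap, List.length_append, List.length_map, ih,
      List.length_range]
    have key : ∀ n : ℕ, ((List.range n).map fun i => height F N + s F N i).sum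
        = n * height F N + ∑ i ∈ Finset.range n, s F N i := by
      intro n
      induction n with
      | zero => simp
      | succ n ihn =>
        rw [List.range_succ, List.map_append, List.sum_append, ihn, Finset.sum_range_succ]
        simp only [List.map_cons, List.map_nil, List.sum_cons, List.sum_nil]
        ring
    exact key _

end CutStack

end

set_option linter.unusedSectionVars false

noncomputable section

namespace CutStack

variable {G : Type*} [AddCommGroup G]

/-! Give the level at position `j` of `C_{N,a}` the address `(j, -a)` in `ℤ × G`. With this sign,
cutting is a translation: the `i`-th piece of every level has its address shifted by `vec F N i`,
and `T` adds `(1, 0)` inside a column.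

Necessity. All differences `vec F M i - vec F M 0` with `M ≥ N` lie in `H = spanGroup F N`. Hence
the address of a point, normalized by `base`, has a class modulo `H` that does not depend on the
generation (`class_unique`), and `T` adds `(1, 0)` to it. Ergodicity of `T` gives `n > 0` with `(n,
0) ∈ H`; then `T^n` preserves classes, and its ergodicity forces `(1, 0) ∈ H`. The `G`-coordinate
alone yields condition 1 from ergodicity of `T`.

Sufficiency. By Lebesgue density, `A` and `B` overlap after translation in products of levels whose
addresses differ by some `v` (`exists_meets`), and `v` may be changed by the difference of the
displacements of any two pieces in a late copy of any prescribed block of operations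
(`Meets.refine`). The goal is `v l = (k l * n, 0)` with a common `n`. Two late blocks with the same
operations have displacements that differ only by multiples of the difference of their heights
(`desc_sub_desc`). Moving back by `ρ * k l` copies in one block and forth in the other therefore
costs a common number of iterations. If in one coordinate the two moves start one copy apart, a
difference of two steps at distance `ρ * |k l|` is left over (`MeetsUpTo.add_single`). Such
differences generate a group containing every `c_{M,i}` (`cGroup_le_periodGroup`), so `v` can be
cancelled once its coordinates lie in `cGroup F`. They can be brought there because, under both
conditions, `ℤ × G` modulo `cGroup F` is generated by the class of `t_{M,0}`, for each `M`, and has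
finite exponent (`exists_smul_mem_cGroup`).

For ergodicity of `T` alone, condition 1 suffices to remove the `G`-coordinate, and one move back
and forth makes the integer coordinate nonnegative. -/

/-! ### Positions of pieces and spacers in the columns -/

theorem one_lt_γ (F : ℕ → CutOp G) (N : ℕ) : 1 < γ F N := (F N).one_lt_cuts

theorem height_pos (F : ℕ → CutOp G) (N : ℕ) : 0 < height F N := by
  induction N with
  | zero => exact Nat.one_pos
  | succ N ih =>
    have := Nat.mul_pos (lt_trans one_pos (one_lt_γ F N)) ih
    rw [height]; omega

theorem width_pos (F : ℕ → CutOp G) (N : ℕ) : 0 < width F N := by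
  induction N with
  | zero => exact one_pos
  | succ N ih =>
    have : (0 : ℝ) < γ F N := by exact_mod_cast lt_trans one_pos (one_lt_γ F N)
    exact div_pos ih this

theorem γ_mul_width_succ (F : ℕ → CutOp G) (N : ℕ) :
    (γ F N : ℝ) * width F (N + 1) = width F N := by
  have : (0 : ℝ) < γ F N := by exact_mod_cast lt_trans one_pos (one_lt_γ F N)
  rw [width]; field_simp

/-- The position in `C_{N+1,a}` of the bottom level of its `i`-th block. -/
def pos (F : ℕ → CutOp G) (N i : ℕ) : ℕ := i * height F N + ∑ k ∈ Finset.range i, s F N k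

theorem pos_succ (F : ℕ → CutOp G) (N i : ℕ) :
    pos F N (i + 1) = pos F N i + height F N + s F N i := by
  simp only [pos, Finset.sum_range_succ]; ring

theorem pos_γ (F : ℕ → CutOp G) (N : ℕ) : pos F N (γ F N) = height F (N + 1) := rfl

theorem pos_mono (F : ℕ → CutOp G) (N : ℕ) : Monotone (pos F N) :=
  monotone_nat_of_le_succ fun i => by rw [pos_succ]; omega

theorem pos_add_height_le (F : ℕ → CutOp G) (N : ℕ) {i : ℕ} (hi : i < γ F N) :
    pos F N i + height F N + s F N i ≤ height F (N + 1) := by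
  rw [← pos_succ, ← pos_γ]; exact pos_mono F N hi

theorem height_strictMono (F : ℕ → CutOp G) : StrictMono (height F) := by
  refine strictMono_nat_of_lt_succ fun N => ?_
  have h1 := pos_add_height_le F N (one_lt_γ F N)
  have h2 := height_pos F N
  have : pos F N 1 = 1 * height F N + s F N 0 := by simp [pos]
  omega

/-- The part of `C_{N+1,a}` made of the `i`-th pieces and the spacers above them. -/
def block (F : ℕ → CutOp G) (N : ℕ) (a : G) (i : ℕ) : List (ℝ × G) :=
  (column F N (a + g F N i)).map (fun p => (p.1 + i * width F (N + 1), p.2)) ++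
      (List.range (s F N i)).map (fun (j : ℕ) =>
        (height F N * width F N
          + ((∑ k ∈ Finset.range i, s F N k : ℕ) + j) * width F (N + 1), a))

theorem column_succ (F : ℕ → CutOp G) (N : ℕ) (a : G) :
    column F (N + 1) a = (List.range (γ F N)).flatMap (block F N a) := rfl

theorem length_block (F : ℕ → CutOp G) (N : ℕ) (a : G) (i : ℕ) :
    (block F N a i).length = height F N + s F N i := by
  simp [block, length_column]

theorem length_flatMap_block (F : ℕ → CutOp G) (N : ℕ) (a : G) (n : ℕ) :
    ((List.range n).flatMap (block F N a)).length = pos F N n := by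
  induction n with
  | zero => simp [pos]
  | succ n ih =>
    rw [List.range_succ, List.flatMap_append, List.length_append, ih, pos_succ]
    simp [length_block, add_assoc]

theorem flatMap_block_getElem? (F : ℕ → CutOp G) (N : ℕ) (a : G) {n i j : ℕ} (hi : i < n)
    (hj : j < height F N + s F N i) :
    ((List.range n).flatMap (block F N a))[pos F N i + j]? = (block F N a i)[j]? := by
  induction n with
  | zero => omega
  | succ n ih =>
    rw [List.range_succ, List.flatMap_append]
    rcases Nat.lt_succ_iff_lt_or_eq.1 hi with h | rfl
    · have h1 := pos_mono F N (Nat.succ_le_of_lt h)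
      rw [Nat.succ_eq_add_one, pos_succ] at h1
      rw [List.getElem?_append_left (by rw [length_flatMap_block]; omega), ih h]
    · rw [List.getElem?_append_right (by rw [length_flatMap_block]; omega), length_flatMap_block]
      simp

theorem column_succ_getElem?_piece (F : ℕ → CutOp G) (N : ℕ) (a : G) {i j : ℕ} (hi : i < γ F N)
    (hj : j < height F N) :
    (column F (N + 1) a)[pos F N i + j]? = ((column F N (a + g F N i))[j]?).map
      fun p => (p.1 + i * width F (N + 1), p.2) := by
  rw [column_succ, flatMap_block_getElem? F N a hi (by omega), block,
    List.getElem?_append_left (by simpa [length_column] using hj), List.getElem?_map]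

theorem column_succ_getElem?_spacer (F : ℕ → CutOp G) (N : ℕ) (a : G) {i j : ℕ} (hi : i < γ F N)
    (hj : j < s F N i) :
    (column F (N + 1) a)[pos F N i + height F N + j]? = some (height F N * width F N
          + ((∑ k ∈ Finset.range i, s F N k : ℕ) + j) * width F (N + 1), a) := by
  rw [column_succ, add_assoc, flatMap_block_getElem? F N a hi (by omega), block,
    List.getElem?_append_right (by simp [length_column])]
  simp [length_column, hj]

/-- The positions in a column of generation `N + 1`. -/
theorem exists_pos_add (F : ℕ → CutOp G) (N : ℕ) {m : ℕ} (hm : m < height F (N + 1)) :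
    ∃ i < γ F N, ∃ j, j < height F N + s F N i ∧ m = pos F N i + j := by
  rw [← pos_γ] at hm
  generalize γ F N = n at hm
  induction n with
  | zero => simp [pos] at hm
  | succ n ih =>
    by_cases h : m < pos F N n
    · obtain ⟨i, hi, hj⟩ := ih h
      exact ⟨i, hi.trans (Nat.lt_succ_self n), hj⟩
    · rw [pos_succ] at hm
      exact ⟨n, Nat.lt_succ_self n, m - pos F N n, by omega, by omega⟩

/-! ### Addresses of levels and disjointness -/

/-- The levels of generation `N` are addressed by `(j, -a)`, where `a` is the index of the column
and `j` the position in it. -/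
def Valid (F : ℕ → CutOp G) (N : ℕ) (z : ℤ × G) : Prop := 0 ≤ z.1 ∧ z.1 < height F N

/-- The entry of the column with the given address. -/
def entry (F : ℕ → CutOp G) (N : ℕ) (z : ℤ × G) : ℝ × G :=
  ((column F N (-z.2))[z.1.toNat]?).getD (0, 0)

theorem getElem?_eq_entry {F : ℕ → CutOp G} {N : ℕ} {z : ℤ × G} (hz : Valid F N z) :
    (column F N (-z.2))[z.1.toNat]? = some (entry F N z) := by
  have : z.1.toNat < (column F N (-z.2)).length := by
    rw [length_column]; have := hz.1; have := hz.2; omega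
  simp [entry, this]

theorem entry_eq_of_getElem? {F : ℕ → CutOp G} {N : ℕ} {a : G} {j : ℕ} {p : ℝ × G}
    (h : (column F N a)[j]? = some p) : Valid F N (j, -a) ∧ entry F N (j, -a) = p := by
  obtain ⟨hj, hp⟩ := List.getElem?_eq_some_iff.1 h
  rw [length_column] at hj
  refine ⟨⟨by simp, by simpa using hj⟩, ?_⟩
  simp [entry, h]

/-- The displacement of the address of the `i`-th piece of a level of generation `N`. -/
def vec (F : ℕ → CutOp G) (N i : ℕ) : ℤ × G := (pos F N i, g F N i)

theorem Valid.child {F : ℕ → CutOp G} {N : ℕ} {z : ℤ × G} (hz : Valid F N z) {i : ℕ}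
    (hi : i < γ F N) : Valid F (N + 1) (z + vec F N i) := by
  have h1 := pos_add_height_le F N hi
  obtain ⟨h2, h3⟩ := hz
  simp only [Valid, vec, Prod.fst_add]
  omega

theorem entry_child {F : ℕ → CutOp G} {N : ℕ} {z : ℤ × G} (hz : Valid F N z) {i : ℕ}
    (hi : i < γ F N) : entry F (N + 1) (z + vec F N i) =
      ((entry F N z).1 + i * width F (N + 1), (entry F N z).2) := by
  have h1 : (z + vec F N i).1.toNat = pos F N i + z.1.toNat := by
    have := hz.1; simp only [vec, Prod.fst_add]; omega
  have h2 : -(z + vec F N i).2 + g F N i = -z.2 := by simp [vec]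
  rw [entry, h1, column_succ_getElem?_piece F N _ hi (by have := hz.1; have := hz.2; omega), h2,
    getElem?_eq_entry hz]
  rfl

/-- The level with the given address. -/
def lev (F : ℕ → CutOp G) (N : ℕ) (z : ℤ × G) : Set (ℝ × G) := level F N (entry F N z)

theorem mem_lev {F : ℕ → CutOp G} {N : ℕ} {z : ℤ × G} {x : ℝ × G} : x ∈ lev F N z ↔
    (entry F N z).1 ≤ x.1 ∧ x.1 < (entry F N z).1 + width F N ∧ x.2 = (entry F N z).2 := by
  simp [lev, level, Set.mem_prod, and_assoc]

theorem exists_child {F : ℕ → CutOp G} {N : ℕ} {z : ℤ × G} (hz : Valid F N z) {x : ℝ × G}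
    (hx : x ∈ lev F N z) : ∃ i < γ F N, x ∈ lev F (N + 1) (z + vec F N i) := by
  rw [mem_lev] at hx
  obtain ⟨h1, h2, h3⟩ := hx
  have hw := width_pos F (N + 1)
  have h0 : 0 ≤ (x.1 - (entry F N z).1) / width F (N + 1) := div_nonneg (by linarith) hw.le
  refine ⟨⌊(x.1 - (entry F N z).1) / width F (N + 1)⌋₊, ?_, ?_⟩
  · rw [Nat.floor_lt h0, div_lt_iff₀ hw, γ_mul_width_succ]; linarith
  · have hi : ⌊(x.1 - (entry F N z).1) / width F (N + 1)⌋₊ < γ F N := by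
      rw [Nat.floor_lt h0, div_lt_iff₀ hw, γ_mul_width_succ]; linarith
    have h4 := Nat.floor_le h0
    have h5 := Nat.lt_floor_add_one ((x.1 - (entry F N z).1) / width F (N + 1))
    rw [le_div_iff₀ hw] at h4
    rw [div_lt_iff₀ hw] at h5
    rw [mem_lev, entry_child hz hi]
    exact ⟨by linarith, by linarith, h3⟩

theorem mem_lev_of_mem_child {F : ℕ → CutOp G} {N : ℕ} {z : ℤ × G} (hz : Valid F N z) {i : ℕ}
    (hi : i < γ F N) {x : ℝ × G} (hx : x ∈ lev F (N + 1) (z + vec F N i)) : x ∈ lev F N z := by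
  rw [mem_lev, entry_child hz hi] at hx
  obtain ⟨h1, h2, h3⟩ := hx
  have hw := width_pos F (N + 1)
  have h4 : ((i + 1 : ℕ) : ℝ) * width F (N + 1) ≤ γ F N * width F (N + 1) := by
    gcongr; exact hi
  rw [γ_mul_width_succ] at h4
  push_cast at h4
  have : 0 ≤ (i : ℝ) * width F (N + 1) := by positivity
  rw [mem_lev]
  exact ⟨by simp at h1; linarith, by simp at h2; linarith, h3⟩

/-- An address of generation `N + 1` is that of a piece or of a spacer. -/
theorem Valid.cases_succ {F : ℕ → CutOp G} {N : ℕ} {z : ℤ × G} (hz : Valid F (N + 1) z) :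
    (∃ i < γ F N, ∃ z', Valid F N z' ∧ z = z' + vec F N i) ∨
    (∃ i < γ F N, ∃ j < s F N i, z.1 = pos F N i + height F N + j ∧
      entry F (N + 1) z = (height F N * width F N
          + ((∑ k ∈ Finset.range i, s F N k : ℕ) + j) * width F (N + 1), -z.2)) := by
  obtain ⟨h1, h2⟩ := hz
  obtain ⟨i, hi, j, hj, hm⟩ := exists_pos_add F N (m := z.1.toNat) (by omega)
  by_cases h : j < height F N
  · refine .inl ⟨i, hi, z - vec F N i, ?_, by simp⟩
    simp only [Valid, vec, Prod.fst_sub]; omega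
  · refine .inr ⟨i, hi, j - height F N, by omega, by omega, ?_⟩
    have h3 : z.1.toNat = pos F N i + height F N + (j - height F N) := by omega
    rw [entry, h3, column_succ_getElem?_spacer F N _ hi (by omega)]
    rfl

theorem entry_bounds {F : ℕ → CutOp G} {N : ℕ} {z : ℤ × G} (hz : Valid F N z) :
    0 ≤ (entry F N z).1 ∧ (entry F N z).1 + width F N ≤ height F N * width F N := by
  induction N generalizing z with
  | zero =>
    have : z.1 = 0 := by have := hz.1; have := hz.2; simp [height] at this; omega
    simp [entry, this, column, height]
  | succ N ih =>
    have hw := width_pos F (N + 1)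
    have hγ := γ_mul_width_succ F N
    have hh : (height F (N + 1) : ℝ) * width F (N + 1) = height F N * width F N
        + (∑ k ∈ Finset.range (γ F N), s F N k : ℕ) * width F (N + 1) := by
      rw [height, ← hγ]; push_cast; ring
    rcases hz.cases_succ with ⟨i, hi, z', hz', rfl⟩ | ⟨i, hi, j, hj, -, he⟩
    · rw [entry_child hz' hi]
      have h4 : ((i + 1 : ℕ) : ℝ) * width F (N + 1) ≤ γ F N * width F (N + 1) := by
        gcongr; exact hi
      push_cast at h4
      obtain ⟨h5, h6⟩ := ih hz'
      refine ⟨by positivity, ?_⟩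
      have : 0 ≤ ((∑ k ∈ Finset.range (γ F N), s F N k : ℕ) : ℝ) * width F (N + 1) := by positivity
      simp only
      linarith
    · rw [he]
      have hw' := width_pos F N
      refine ⟨by positivity, ?_⟩
      rw [hh]
      have : (∑ k ∈ Finset.range i, s F N k) + j + 1 ≤ ∑ k ∈ Finset.range (γ F N), s F N k := by
        calc _ ≤ ∑ k ∈ Finset.range (i + 1), s F N k := by rw [Finset.sum_range_succ]; omega
          _ ≤ _ := Finset.sum_le_sum_of_subset (Finset.range_mono hi)
      have h7 : (((∑ k ∈ Finset.range i, s F N k) + j + 1 : ℕ) : ℝ) * width F (N + 1) ≤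
          (∑ k ∈ Finset.range (γ F N), s F N k : ℕ) * width F (N + 1) := by gcongr
      push_cast at h7 ⊢
      linarith

theorem sum_range_add_inj {f : ℕ → ℕ} {i i' j j' : ℕ} (hj : j < f i) (hj' : j' < f i')
    (h : (∑ k ∈ Finset.range i, f k) + j = (∑ k ∈ Finset.range i', f k) + j') :
    i = i' ∧ j = j' := by
  have key : ∀ a b c d : ℕ, c < f a → a < b →
      (∑ k ∈ Finset.range a, f k) + c < (∑ k ∈ Finset.range b, f k) + d := by
    intro a b c d hc hab
    have := Finset.sum_le_sum_of_subset (f := f) (Finset.range_mono (Nat.succ_le_of_lt hab))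
    rw [Nat.succ_eq_add_one, Finset.sum_range_succ] at this
    omega
  rcases lt_trichotomy i i' with hi | rfl | hi
  · have := key i i' j j' hj hi; omega
  · exact ⟨rfl, by omega⟩
  · have := key i' i j' j hj' hi; omega

theorem nat_eq_of_mem_cell {w x o : ℝ} {i i' : ℕ} (hw : 0 < w) (h1 : o + i * w ≤ x)
    (h2 : x < o + i * w + w) (h1' : o + i' * w ≤ x) (h2' : x < o + i' * w + w) : i = i' := by
  have h3 : (i : ℝ) * w < (i' + 1) * w := by linarith
  have h4 : (i' : ℝ) * w < (i + 1) * w := by linarith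
  have h5 := lt_of_mul_lt_mul_right h3 hw.le
  have h6 := lt_of_mul_lt_mul_right h4 hw.le
  norm_cast at h5 h6
  omega

/-- Levels of the same generation with different addresses are disjoint. -/
theorem eq_of_mem_lev {F : ℕ → CutOp G} {N : ℕ} {z z' : ℤ × G} (hz : Valid F N z)
    (hz' : Valid F N z') {x : ℝ × G} (hx : x ∈ lev F N z) (hx' : x ∈ lev F N z') : z = z' := by
  induction N generalizing z z' with
  | zero =>
    have h : z.1 = 0 := by have := hz.1; have := hz.2; simp [height] at this; omega
    have h' : z'.1 = 0 := by have := hz'.1; have := hz'.2; simp [height] at this; omega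
    rw [mem_lev] at hx hx'
    simp only [entry, h, h', column] at hx hx'
    simp at hx hx'
    ext
    · rw [h, h']
    · exact neg_injective (hx.2.2.symm.trans hx'.2.2)
  | succ N ih =>
    have hw := width_pos F (N + 1)
    -- A piece of an old level lies to the left of `height F N * width F N`, a new spacer to the
    -- right of it.
    have aux : ∀ {z z' : ℤ × G} {i i' j : ℕ}, Valid F N z → i < γ F N →
        x ∈ lev F (N + 1) (z + vec F N i) → x ∈ lev F (N + 1) z' →
        entry F (N + 1) z' = (height F N * width F N
          + ((∑ k ∈ Finset.range i', s F N k : ℕ) + j) * width F (N + 1), -z'.2) → False := by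
      intro z z' i i' j hz hi hx hx' he
      have h1 := (mem_lev.1 (mem_lev_of_mem_child hz hi hx)).2.1
      have h2 := (entry_bounds hz).2
      have h3 := (mem_lev.1 hx').1
      rw [he] at h3
      have : 0 ≤ (((∑ k ∈ Finset.range i', s F N k : ℕ) : ℝ) + j) * width F (N + 1) := by positivity
      simp only at h3
      linarith
    rcases hz.cases_succ with ⟨i, hi, y, hy, rfl⟩ | ⟨i, hi, j, hj, h1, he⟩ <;>
    rcases hz'.cases_succ with ⟨i', hi', y', hy', rfl⟩ | ⟨i', hi', j', hj', h1', he'⟩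
    · have := ih hy hy' (mem_lev_of_mem_child hy hi hx) (mem_lev_of_mem_child hy' hi' hx')
      subst this
      rw [mem_lev, entry_child hy ‹_›] at hx hx'
      rw [nat_eq_of_mem_cell hw hx.1 hx.2.1 hx'.1 hx'.2.1]
    · exact (aux hy hi hx hx' he').elim
    · exact (aux hy' hi' hx' hx he).elim
    · rw [mem_lev, he] at hx
      rw [mem_lev, he'] at hx'
      have h2 := nat_eq_of_mem_cell (i := (∑ k ∈ Finset.range i, s F N k) + j)
        (i' := (∑ k ∈ Finset.range i', s F N k) + j') (x := x.1) (o := height F N * width F N) hw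
        (by push_cast; simpa using hx.1) (by push_cast; simpa using hx.2.1)
        (by push_cast; simpa using hx'.1) (by push_cast; simpa using hx'.2.1)
      obtain ⟨rfl, rfl⟩ := sum_range_add_inj hj hj' h2
      ext
      · rw [h1, h1']
      · exact neg_injective (hx.2.2.symm.trans hx'.2.2)

/-! ### Pieces across several generations -/

/-- The number of pieces of generation `N + r` of a level of generation `N`. -/
def pieces (F : ℕ → CutOp G) (r N : ℕ) : ℕ := ∏ i ∈ Finset.range r, γ F (N + i)

/-- The displacement of the address of the `p`-th piece of generation `N + r` of a level of
generation `N`, the pieces being numbered by their order in a column of generation `N + r`. -/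
def desc (F : ℕ → CutOp G) : ℕ → ℕ → ℕ → ℤ × G
  | 0, _, _ => 0
  | r + 1, N, p => vec F N (p % γ F N) + desc F r (N + 1) (p / γ F N)

/-- The distance from the left end of a level of generation `N` to that of its `p`-th piece of
generation `N + r`. -/
def offset (F : ℕ → CutOp G) : ℕ → ℕ → ℕ → ℝ
  | 0, _, _ => 0
  | r + 1, N, p => (p % γ F N : ℕ) * width F (N + 1) + offset F r (N + 1) (p / γ F N)

theorem pieces_succ (F : ℕ → CutOp G) (r N : ℕ) :
    pieces F (r + 1) N = γ F N * pieces F r (N + 1) := by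
  rw [pieces, Finset.prod_range_succ', pieces, mul_comm]
  simp only [add_zero, add_assoc, add_comm 1]

/-- There are at least `2 ^ r` pieces. So a block of `L` operations always has room for the piece
indices below `L`. -/
theorem lt_pieces (F : ℕ → CutOp G) (r N : ℕ) : r < pieces F r N := by
  refine lt_of_lt_of_le Nat.lt_two_pow_self (?_ : 2 ^ r ≤ _)
  calc 2 ^ r = ∏ i ∈ Finset.range r, 2 := by simp
    _ ≤ _ := Finset.prod_le_prod' fun i _ => one_lt_γ F (N + i)

theorem pieces_mul_width (F : ℕ → CutOp G) (r N : ℕ) :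
    (pieces F r N : ℝ) * width F (N + r) = width F N := by
  induction r with
  | zero => simp [pieces]
  | succ r ih =>
    rw [pieces, Finset.prod_range_succ, ← pieces, Nat.cast_mul, mul_assoc, ← add_assoc,
      γ_mul_width_succ, ih]

theorem exists_width_lt (F : ℕ → CutOp G) {ε : ℝ} (hε : 0 < ε) :
    ∃ K, ∀ N ≥ K, width F N < ε := by
  obtain ⟨K, hK⟩ := exists_nat_gt (1 / ε)
  refine ⟨K, fun N hN => ?_⟩
  have h1 := pieces_mul_width F N 0
  have h2 : (N : ℝ) < pieces F N 0 := by exact_mod_cast lt_pieces F N 0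
  have h3 := width_pos F N
  have h4 : (K : ℝ) ≤ N := by exact_mod_cast hN
  rw [zero_add] at h1
  change _ = (1 : ℝ) at h1
  rw [div_lt_iff₀ hε] at hK
  by_contra! h
  have : (pieces F N 0 : ℝ) * ε ≤ pieces F N 0 * width F N := by gcongr
  nlinarith

theorem Valid.desc {F : ℕ → CutOp G} {N : ℕ} {z : ℤ × G} (hz : Valid F N z) (r p : ℕ) :
    Valid F (N + r) (z + desc F r N p) := by
  induction r generalizing N z p with
  | zero => simpa [CutStack.desc] using hz
  | succ r ih =>
    rw [CutStack.desc, ← add_assoc z, ← add_assoc N r 1, add_right_comm N r 1]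
    exact ih (hz.child (Nat.mod_lt _ (lt_trans one_pos (one_lt_γ F N)))) _

theorem entry_desc {F : ℕ → CutOp G} {N : ℕ} {z : ℤ × G} (hz : Valid F N z) (r p : ℕ) :
    entry F (N + r) (z + desc F r N p) =
      ((entry F N z).1 + offset F r N p, (entry F N z).2) := by
  induction r generalizing N z p with
  | zero => simp [desc, offset]
  | succ r ih =>
    have h := Nat.mod_lt p (lt_trans one_pos (one_lt_γ F N))
    rw [desc, ← add_assoc z, ← add_assoc N r 1, add_right_comm N r 1, ih (hz.child h),
      entry_child hz h, offset]
    simp only [add_assoc]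

theorem offset_nonneg (F : ℕ → CutOp G) (r N p : ℕ) : 0 ≤ offset F r N p := by
  induction r generalizing N p with
  | zero => exact le_rfl
  | succ r ih => exact add_nonneg (mul_nonneg (Nat.cast_nonneg _) (width_pos F _).le) (ih _ _)

theorem offset_add_width_le (F : ℕ → CutOp G) (r N p : ℕ) :
    offset F r N p + width F (N + r) ≤ width F N := by
  induction r generalizing N p with
  | zero => simp [offset]
  | succ r ih =>
    have h := Nat.mod_lt p (lt_trans one_pos (one_lt_γ F N))
    have h1 := ih (N + 1) (p / γ F N)
    have hw := width_pos F (N + 1)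
    have h4 : ((p % γ F N + 1 : ℕ) : ℝ) * width F (N + 1) ≤ γ F N * width F (N + 1) := by
      gcongr; exact h
    rw [γ_mul_width_succ] at h4
    push_cast at h4
    rw [offset, ← add_assoc N r 1, add_right_comm N r 1]
    linarith

theorem exists_offset (F : ℕ → CutOp G) (r N : ℕ) {y : ℝ} (h0 : 0 ≤ y) (h1 : y < width F N) :
    ∃ p, offset F r N p ≤ y ∧ y < offset F r N p + width F (N + r) := by
  induction r generalizing N y with
  | zero => exact ⟨0, by simpa [offset] using ⟨h0, h1⟩⟩
  | succ r ih =>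
    have hw := width_pos F (N + 1)
    have h0' : 0 ≤ y / width F (N + 1) := div_nonneg h0 hw.le
    have hi : ⌊y / width F (N + 1)⌋₊ < γ F N := by
      rwa [Nat.floor_lt h0', div_lt_iff₀ hw, γ_mul_width_succ]
    have h4 := Nat.floor_le h0'
    have h5 := Nat.lt_floor_add_one (y / width F (N + 1))
    rw [le_div_iff₀ hw] at h4
    rw [div_lt_iff₀ hw] at h5
    obtain ⟨p, hp⟩ := ih (N + 1) (y := y - ⌊y / width F (N + 1)⌋₊ * width F (N + 1))
      (by linarith) (by linarith)
    refine ⟨⌊y / width F (N + 1)⌋₊ + γ F N * p, ?_⟩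
    rw [offset, Nat.add_mul_mod_self_left, Nat.mod_eq_of_lt hi,
      Nat.add_mul_div_left _ _ (lt_trans one_pos (one_lt_γ F N)), Nat.div_eq_of_lt hi, zero_add,
      ← add_assoc N r 1, add_right_comm N r 1]
    exact ⟨by linarith [hp.1], by linarith [hp.2]⟩

/-! ### The transformation in terms of addresses -/

theorem infix_pair_iff {α : Type*} {p q : α} {l : List α} :
    [p, q] <:+: l ↔ ∃ j, l[j]? = some p ∧ l[j + 1]? = some q := by
  constructor
  · rintro ⟨u, v, rfl⟩
    refine ⟨u.length, ?_, ?_⟩ <;> simp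
  · rintro ⟨j, h1, h2⟩
    obtain ⟨hj, rfl⟩ := List.getElem?_eq_some_iff.1 h1
    obtain ⟨hj', rfl⟩ := List.getElem?_eq_some_iff.1 h2
    refine ⟨l.take j, l.drop (j + 2), ?_⟩
    conv_rhs => rw [← List.take_append_drop j l, List.drop_eq_getElem_cons hj,
      List.drop_eq_getElem_cons hj']
    simp

/-- The address of the level above. -/
abbrev up (z : ℤ × G) : ℤ × G := z + (1, 0)

theorem above_iff {F : ℕ → CutOp G} {x y : ℝ × G} : Above F x y ↔
    ∃ N z, Valid F N z ∧ Valid F N (up z) ∧ x ∈ lev F N z ∧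
      y = (x.1 + ((entry F N (up z)).1 - (entry F N z).1), (entry F N (up z)).2) := by
  constructor
  · rintro ⟨N, a, p, q, h, hx, rfl⟩
    obtain ⟨j, h1, h2⟩ := infix_pair_iff.1 h
    obtain ⟨hv, he⟩ := entry_eq_of_getElem? h1
    obtain ⟨hv', he'⟩ := entry_eq_of_getElem? h2
    have hu : up ((j : ℤ), -a) = (((j + 1 : ℕ) : ℤ), -a) := by simp [up]
    refine ⟨N, (j, -a), hv, by rwa [hu], by rwa [lev, he], by rw [hu, he, he']⟩
  · rintro ⟨N, z, hz, hz', hx, rfl⟩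
    refine ⟨N, -z.2, entry F N z, entry F N (up z), infix_pair_iff.2 ⟨z.1.toNat,
      getElem?_eq_entry hz, ?_⟩, hx, rfl⟩
    rw [← getElem?_eq_entry hz']
    have := hz.1
    simp only [up, Prod.fst_add, Prod.snd_add, add_zero]
    congr 1
    omega

theorem up_add (z v : ℤ × G) : up z + v = up (z + v) := add_right_comm _ _ _

/-- A witness for `Above` can be moved to any later generation. -/
theorem exists_above_witness {F : ℕ → CutOp G} {N : ℕ} {z : ℤ × G} {x : ℝ × G}
    (hz : Valid F N z) (hz' : Valid F N (up z)) (hx : x ∈ lev F N z) (r : ℕ) :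
    ∃ v, Valid F (N + r) v ∧ Valid F (N + r) (up v) ∧ x ∈ lev F (N + r) v ∧
      (entry F (N + r) (up v)).1 - (entry F (N + r) v).1 =
        (entry F N (up z)).1 - (entry F N z).1 ∧
      (entry F (N + r) (up v)).2 = (entry F N (up z)).2 := by
  have h := mem_lev.1 hx
  obtain ⟨p, hp⟩ := exists_offset F r N (y := x.1 - (entry F N z).1) (by linarith) (by linarith)
  refine ⟨z + desc F r N p, hz.desc r p, ?_, ?_, ?_, ?_⟩
  · rw [← up_add]; exact hz'.desc r p
  · rw [mem_lev, entry_desc hz]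
    exact ⟨by linarith [hp.1], by linarith [hp.2], h.2.2⟩
  · rw [← up_add, entry_desc hz, entry_desc hz']; simp
  · rw [← up_add, entry_desc hz']

theorem mem_lev_of_translate {F : ℕ → CutOp G} {N : ℕ} {z : ℤ × G} {x : ℝ × G} (v : ℤ × G)
    (hx : x ∈ lev F N z) :
    (x.1 + ((entry F N v).1 - (entry F N z).1), (entry F N v).2) ∈ lev F N v := by
  have := mem_lev.1 hx
  rw [mem_lev]
  exact ⟨by simp only; linarith, by simp only; linarith, rfl⟩

/-- Refining both witnesses to a common generation reduces uniqueness of the point above or below to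
disjointness of levels. -/
theorem above_pair {F : ℕ → CutOp G} {x x' y y' : ℝ × G} (h : Above F x y) (h' : Above F x' y') :
    ∃ N z z', Valid F N z ∧ Valid F N (up z) ∧ Valid F N z' ∧ Valid F N (up z') ∧
      x ∈ lev F N z ∧ x' ∈ lev F N z' ∧
      y = (x.1 + ((entry F N (up z)).1 - (entry F N z).1), (entry F N (up z)).2) ∧
      y' = (x'.1 + ((entry F N (up z')).1 - (entry F N z').1), (entry F N (up z')).2) := by
  obtain ⟨N, z, h1, h2, h3, rfl⟩ := above_iff.1 h
  obtain ⟨N', z', h1', h2', h3', rfl⟩ := above_iff.1 h'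
  obtain ⟨v, a1, a2, a3, a4, a5⟩ := exists_above_witness h1 h2 h3 N'
  obtain ⟨v', b1, b2, b3, b4, b5⟩ := exists_above_witness h1' h2' h3' N
  rw [add_comm N' N] at b1 b2 b3 b4 b5
  exact ⟨N + N', v, v', a1, a2, b1, b2, a3, b3, by rw [a4, a5], by rw [b4, b5]⟩

theorem Above.right_unique {F : ℕ → CutOp G} {x y y' : ℝ × G} (h : Above F x y)
    (h' : Above F x y') : y = y' := by
  obtain ⟨N, z, z', h1, h2, h3, h4, h5, h6, rfl, rfl⟩ := above_pair h h'
  rw [eq_of_mem_lev h1 h3 h5 h6]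

theorem Above.left_unique {F : ℕ → CutOp G} {x x' y : ℝ × G} (h : Above F x y)
    (h' : Above F x' y) : x = x' := by
  obtain ⟨N, z, z', h1, h2, h3, h4, h5, h6, rfl, h8⟩ := above_pair h h'
  have h9 := mem_lev_of_translate (up z) h5
  have h10 := mem_lev_of_translate (up z') h6
  rw [← h8] at h10
  have h11 : z = z' := add_right_cancel (eq_of_mem_lev h2 h4 h9 h10)
  subst h11
  ext
  · have := congrArg Prod.fst h8
    simpa using this
  · rw [(mem_lev.1 h5).2.2, (mem_lev.1 h6).2.2]

theorem T_eq_of_above {F : ℕ → CutOp G} {x y : ℝ × G} (h : Above F x y) : T F x = y := by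
  have h' : ∃ y, Above F x y := ⟨y, h⟩
  rw [T, dif_pos h']
  exact h'.choose_spec.right_unique h

theorem Tinv_eq_of_above {F : ℕ → CutOp G} {x y : ℝ × G} (h : Above F x y) : Tinv F y = x := by
  have h' : ∃ x, Above F x y := ⟨x, h⟩
  rw [Tinv, dif_pos h']
  exact h'.choose_spec.left_unique h

/-- The point of the level with address `z` at distance `u` from its left end. -/
def point (F : ℕ → CutOp G) (N : ℕ) (z : ℤ × G) (u : ℝ) : ℝ × G :=
  ((entry F N z).1 + u, (entry F N z).2)

theorem point_mem_lev {F : ℕ → CutOp G} {N : ℕ} {z : ℤ × G} {u : ℝ}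
    (hu : u ∈ Set.Ico 0 (width F N)) : point F N z u ∈ lev F N z := by
  rw [mem_lev]; exact ⟨by simpa [point] using hu.1, by simpa [point] using hu.2, rfl⟩

theorem above_point {F : ℕ → CutOp G} {N : ℕ} {z : ℤ × G} {u : ℝ} (hz : Valid F N z)
    (hz' : Valid F N (up z)) (hu : u ∈ Set.Ico 0 (width F N)) :
    Above F (point F N z u) (point F N (up z) u) :=
  above_iff.2 ⟨N, z, hz, hz', point_mem_lev hu, Prod.ext (by simp only [point]; ring) rfl⟩

theorem T_iterate_point {F : ℕ → CutOp G} {N : ℕ} {z : ℤ × G} {u : ℝ} {n : ℕ} (hz : Valid F N z)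
    (hz' : Valid F N (z + ((n : ℤ), 0))) (hu : u ∈ Set.Ico 0 (width F N)) :
    (T F)^[n] (point F N z u) = point F N (z + ((n : ℤ), 0)) u := by
  induction n with
  | zero =>
    have h : z + (((0 : ℕ) : ℤ), 0) = z := by ext <;> simp
    rw [h]; rfl
  | succ n ih =>
    have h1 : Valid F N (z + ((n : ℤ), 0)) := by
      obtain ⟨a, b⟩ := hz
      obtain ⟨c, d⟩ := hz'
      simp only [Valid, Prod.fst_add] at *
      push_cast at *
      omega
    have h2 : z + (((n + 1 : ℕ) : ℤ), 0) = up (z + ((n : ℤ), 0)) := by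
      ext <;> simp [up, add_assoc]
    rw [h2] at hz' ⊢
    rw [Function.iterate_succ_apply', ih h1, T_eq_of_above (above_point h1 hz' hu)]

theorem Tinv_iterate_point {F : ℕ → CutOp G} {N : ℕ} {z : ℤ × G} {u : ℝ} {n : ℕ}
    (hz : Valid F N z) (hz' : Valid F N (z + (-(n : ℤ), 0))) (hu : u ∈ Set.Ico 0 (width F N)) :
    (Tinv F)^[n] (point F N z u) = point F N (z + (-(n : ℤ), 0)) u := by
  induction n with
  | zero =>
    have h : z + (-((0 : ℕ) : ℤ), 0) = z := by ext <;> simp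
    rw [h]; rfl
  | succ n ih =>
    have h1 : Valid F N (z + (-(n : ℤ), 0)) := by
      obtain ⟨a, b⟩ := hz
      obtain ⟨c, d⟩ := hz'
      simp only [Valid, Prod.fst_add] at *
      push_cast at *
      omega
    have h2 : z + (-(n : ℤ), 0) = up (z + (-((n + 1 : ℕ) : ℤ), 0)) := by
      ext <;> simp [up, add_assoc]
    rw [Function.iterate_succ_apply', ih h1]
    rw [h2] at h1 ⊢
    exact Tinv_eq_of_above (above_point hz' h1 hu)

theorem Tpow_iterate_point {F : ℕ → CutOp G} {N : ℕ} {z : ℤ × G} {u : ℝ} {k : ℤ} {n : ℕ}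
    (hz : Valid F N z) (hz' : Valid F N (z + (k * n, 0))) (hu : u ∈ Set.Ico 0 (width F N)) :
    (Tpow F k)^[n] (point F N z u) = point F N (z + (k * n, 0)) u := by
  rcases k with m | m
  · have h : (Int.ofNat m * n : ℤ) = ((m * n : ℕ) : ℤ) := by simp
    rw [h] at hz' ⊢
    rw [Tpow, ← Function.iterate_mul]
    exact T_iterate_point hz hz' hu
  · have h : (Int.negSucc m * n : ℤ) = -(((m + 1) * n : ℕ) : ℤ) := by
      rw [Int.negSucc_eq]; push_cast; ring
    rw [h] at hz' ⊢
    rw [Tpow, ← Function.iterate_mul]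
    exact Tinv_iterate_point hz hz' hu

/-- Every point of the space has a point above it. -/
theorem exists_mem_lev_up {F : ℕ → CutOp G} {N : ℕ} {z : ℤ × G} {x : ℝ × G} (hz : Valid F N z)
    (hx : x ∈ lev F N z) :
    ∃ r v, Valid F (N + r) v ∧ Valid F (N + r) (up v) ∧ x ∈ lev F (N + r) v := by
  by_contra! hcon
  -- Without a level above it, the point is in the last piece at every generation, so all its levels
  -- share one right end. Their widths tend to zero, while the point stays strictly to the left of
  -- that end.
  have key : ∀ r, ∃ v, Valid F (N + r) v ∧ x ∈ lev F (N + r) v ∧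
      (entry F (N + r) v).1 + width F (N + r) = (entry F N z).1 + width F N := by
    intro r
    induction r with
    | zero => exact ⟨z, hz, hx, rfl⟩
    | succ r ih =>
      obtain ⟨v, h1, h2, h3⟩ := ih
      obtain ⟨i, hi, h4⟩ := exists_child h1 h2
      have h5 := h1.child hi
      refine ⟨v + vec F (N + r) i, h5, h4, ?_⟩
      have h6 : i + 1 = γ F (N + r) := by
        by_contra hne
        refine hcon (r + 1) _ h5 ?_ h4
        have h7 : i + 1 < γ F (N + r) := by omega
        have h8 := pos_add_height_le F (N + r) h7
        rw [pos_succ] at h8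
        have h9 := height_pos F (N + r)
        obtain ⟨h10, h11⟩ := h1
        simp only [Valid, up, vec, Prod.fst_add, ← add_assoc N r 1]
        omega
      rw [← add_assoc N r 1, entry_child h1 hi, ← h3, ← γ_mul_width_succ F (N + r), ← h6]
      push_cast
      ring
  have h0 := mem_lev.1 hx
  obtain ⟨K, hK⟩ := exists_width_lt F (ε := (entry F N z).1 + width F N - x.1) (by linarith)
  obtain ⟨v, -, h2, h3⟩ := key K
  have := hK (N + K) (by omega)
  have := mem_lev.1 h2
  linarith

theorem lev_subset_space {F : ℕ → CutOp G} {N : ℕ} {z : ℤ × G} (hz : Valid F N z) :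
    lev F N z ⊆ space F := fun _ hx =>
  ⟨N, -z.2, entry F N z, List.mem_of_getElem? (getElem?_eq_entry hz), hx⟩

theorem exists_mem_lev {F : ℕ → CutOp G} {x : ℝ × G} (hx : x ∈ space F) :
    ∃ N, ∀ M ≥ N, ∃ z, Valid F M z ∧ x ∈ lev F M z := by
  obtain ⟨N, a, p, hp, hx⟩ := hx
  obtain ⟨j, hj⟩ := List.mem_iff_getElem?.1 hp
  obtain ⟨h1, h2⟩ := entry_eq_of_getElem? hj
  refine ⟨N, fun M hM => ?_⟩
  induction M, hM using Nat.le_induction with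
  | base => exact ⟨(j, -a), h1, by rwa [lev, h2]⟩
  | succ M _ ih =>
    obtain ⟨z, hz, hxz⟩ := ih
    obtain ⟨i, hi, h⟩ := exists_child hz hxz
    exact ⟨_, hz.child hi, h⟩

/-! ### The measure on a level -/

section Measure

variable [MeasurableSpace G] [DiscreteMeasurableSpace G]

theorem measurableSet_lev (F : ℕ → CutOp G) (N : ℕ) (z : ℤ × G) : MeasurableSet (lev F N z) :=
  measurableSet_Ico.prod (measurableSet_singleton _)

theorem measurable_point (F : ℕ → CutOp G) (N : ℕ) (z : ℤ × G) : Measurable (point F N z) :=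
  (measurable_const_add _).prodMk measurable_const

instance sigmaFinite_μ [Countable G] (F : ℕ → CutOp G) : SigmaFinite (μ F) := by
  unfold μ; infer_instance

/-- A level is a copy of an interval. -/
theorem restrict_lev [Countable G] {F : ℕ → CutOp G} {N : ℕ} {z : ℤ × G} (hz : Valid F N z) :
    (μ F).restrict (lev F N z) =
      (volume.restrict (Set.Ico 0 (width F N))).map (point F N z) := by
  have h1 : (volume.restrict (Set.Ico 0 (width F N))).map ((entry F N z).1 + ·) =
      volume.restrict (Set.Ico (entry F N z).1 ((entry F N z).1 + width F N)) := by
    have := (measurePreserving_add_left (volume : Measure ℝ) (entry F N z).1).restrict_preimage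
      (s := Set.Ico (entry F N z).1 ((entry F N z).1 + width F N)) measurableSet_Ico
    rw [← this.map_eq]
    congr 2
    simp
  have h2 : point F N z = (fun y => (y, (entry F N z).2)) ∘ ((entry F N z).1 + ·) := rfl
  rw [μ, Measure.restrict_restrict (measurableSet_lev F N z),
    Set.inter_eq_left.2 (lev_subset_space hz), lev, level, ← Measure.prod_restrict,
    Measure.restrict_singleton, Measure.count_singleton, one_smul, Measure.prod_dirac, ← h1,
    Measure.map_map (by fun_prop) (by fun_prop), h2]

theorem μ_lev_pos [Countable G] {F : ℕ → CutOp G} {N : ℕ} {z : ℤ × G} (hz : Valid F N z) :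
    0 < μ F (lev F N z) := by
  have h : μ F (lev F N z) = (μ F).restrict (lev F N z) Set.univ := by simp
  rw [h, restrict_lev hz, Measure.map_apply (measurable_point F N z) .univ]
  simpa using width_pos F N

end Measure

/-! ### Classes of addresses and necessity of the conditions -/

theorem vec_succ_sub (F : ℕ → CutOp G) (N i : ℕ) : vec F N (i + 1) - vec F N i = t F N i := by
  ext
  · simp only [vec, t, Prod.fst_sub, pos_succ]; push_cast; ring
  · simp [vec, t]

theorem vec_sub_vec_zero (F : ℕ → CutOp G) (N i : ℕ) :
    vec F N i - vec F N 0 = ∑ k ∈ Finset.range i, t F N k := by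
  simp_rw [← vec_succ_sub]; rw [Finset.sum_range_sub]

/-- To reach the next copy of a column of generation `M + 1`, go from its first to its last copy of
a column of generation `M` and then one copy further. The last move would be `t F M 0` but for the
spacers and shifts, and `c F M i` corrects this. No height enters the correction. -/
theorem t_succ (F : ℕ → CutOp G) (M i : ℕ) :
    t F (M + 1) i = (vec F M (γ F M - 1) - vec F M 0) + t F M 0 + c F M i := by
  have h := pos_succ F M (γ F M - 1)
  rw [Nat.sub_add_cancel (one_lt_γ F M).le, pos_γ] at h
  ext
  · simp only [t, vec, c, Prod.fst_sub, Prod.fst_add, h]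
    have : pos F M 0 = 0 := by simp [pos]
    rw [this]; push_cast; ring
  · simp only [t, vec, c, Prod.snd_sub, Prod.snd_add]; abel

/-- The group generated by the vectors in the span condition. -/
def spanGroup (F : ℕ → CutOp G) (N : ℕ) : AddSubgroup (ℤ × G) :=
  AddSubgroup.closure ({v | ∃ i, i + 2 ≤ γ F N ∧ v = t F N i} ∪
      {v | ∃ M i, i + 2 ≤ γ F (M + 1) ∧ v = c F M i})

theorem sum_t_mem {F : ℕ → CutOp G} {M : ℕ} {H : AddSubgroup (ℤ × G)}
    (h : ∀ i, i + 2 ≤ γ F M → t F M i ∈ H) {i : ℕ} (hi : i < γ F M) :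
    vec F M i - vec F M 0 ∈ H := by
  rw [vec_sub_vec_zero]
  exact sum_mem fun k hk => h k (by have := Finset.mem_range.1 hk; omega)

theorem t_mem_spanGroup (F : ℕ → CutOp G) {N M : ℕ} (hM : N ≤ M) :
    ∀ i, i + 2 ≤ γ F M → t F M i ∈ spanGroup F N := by
  induction M, hM using Nat.le_induction with
  | base => exact fun i hi => AddSubgroup.subset_closure (.inl ⟨i, hi, rfl⟩)
  | succ M _ ih =>
    intro i hi
    rw [t_succ]
    have h := one_lt_γ F M
    exact add_mem (add_mem (sum_t_mem ih (by omega)) (ih 0 h))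
      (AddSubgroup.subset_closure (.inr ⟨M, i, hi, rfl⟩))

theorem vec_sub_mem_spanGroup (F : ℕ → CutOp G) {N M : ℕ} (hM : N ≤ M) {i : ℕ}
    (hi : i < γ F M) : vec F M i - vec F M 0 ∈ spanGroup F N :=
  sum_t_mem (t_mem_spanGroup F hM) hi

/-- The displacement of the address of the leftmost piece of generation `M`, up to a constant. -/
def base (F : ℕ → CutOp G) (M : ℕ) : ℤ × G := ∑ m ∈ Finset.range M, vec F m 0

section Invariant

variable {F : ℕ → CutOp G} {N : ℕ} {H : AddSubgroup (ℤ × G)}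

/-- Passing to the `i`-th piece adds `vec F M i`, of which `base` absorbs `vec F M 0`; the rest is
in `H`. -/
theorem exists_mem_lev_class (hH : ∀ M ≥ N, ∀ i < γ F M, vec F M i - vec F M 0 ∈ H) {M : ℕ}
    (hM : N ≤ M) {z : ℤ × G} (hz : Valid F M z) {x : ℝ × G} (hx : x ∈ lev F M z) (r : ℕ) :
    ∃ v, Valid F (M + r) v ∧ x ∈ lev F (M + r) v ∧
      (v - base F (M + r)) - (z - base F M) ∈ H := by
  induction r with
  | zero => exact ⟨z, hz, hx, by simp [H.zero_mem]⟩
  | succ r ih =>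
    obtain ⟨v, h1, h2, h3⟩ := ih
    obtain ⟨i, hi, h4⟩ := exists_child h1 h2
    refine ⟨_, h1.child hi, h4, ?_⟩
    have h5 : v + vec F (M + r) i - base F (M + (r + 1)) - (z - base F M) =
        (v - base F (M + r) - (z - base F M)) + (vec F (M + r) i - vec F (M + r) 0) := by
      rw [← add_assoc M r 1, base, base, base, Finset.sum_range_succ]; abel
    rw [h5]
    exact add_mem h3 (hH _ (by omega) i hi)

/-- The class modulo `H` of the normalized address of a point does not depend on the generation. -/
theorem class_unique (hH : ∀ M ≥ N, ∀ i < γ F M, vec F M i - vec F M 0 ∈ H) {M M' : ℕ}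
    (hM : N ≤ M) (hM' : N ≤ M') {z z' : ℤ × G} (hz : Valid F M z) (hz' : Valid F M' z')
    {x : ℝ × G} (hx : x ∈ lev F M z) (hx' : x ∈ lev F M' z') :
    (z - base F M) - (z' - base F M') ∈ H := by
  obtain ⟨v, h1, h2, h3⟩ := exists_mem_lev_class hH hM hz hx M'
  obtain ⟨v', h1', h2', h3'⟩ := exists_mem_lev_class hH hM' hz' hx' M
  rw [add_comm M' M] at h1' h2' h3'
  obtain rfl := eq_of_mem_lev h1 h1' h2 h2'
  have := sub_mem h3' h3
  rwa [sub_sub_sub_cancel_left] at this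

theorem T_iterate_class (hH : ∀ M ≥ N, ∀ i < γ F M, vec F M i - vec F M 0 ∈ H) {M : ℕ}
    (hM : N ≤ M) {z : ℤ × G} (hz : Valid F M z) {x : ℝ × G} (hx : x ∈ lev F M z) (n : ℕ) :
    ∃ M' ≥ N, ∃ v, Valid F M' v ∧ (T F)^[n] x ∈ lev F M' v ∧
      (v - base F M') - (z - base F M) - ((n : ℤ), 0) ∈ H := by
  induction n with
  | zero =>
    refine ⟨M, hM, z, hz, hx, ?_⟩
    rw [sub_self, zero_sub]
    exact H.neg_mem H.zero_mem
  | succ n ih =>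
    obtain ⟨M', hM', v, h1, h2, h3⟩ := ih
    obtain ⟨r, w, h4, h5, h6⟩ := exists_mem_lev_up h1 h2
    refine ⟨M' + r, by omega, up w, h5, ?_, ?_⟩
    · rw [Function.iterate_succ_apply', T_eq_of_above (above_iff.2 ⟨_, w, h4, h5, h6, rfl⟩)]
      exact mem_lev_of_translate _ h6
    · have h7 := class_unique hH (by omega) hM' h4 h1 h6 h2
      have h8 : (((n + 1 : ℕ) : ℤ), (0 : G)) = ((n : ℤ), 0) + (1, 0) := by ext <;> simp
      have h9 := add_mem h7 h3
      rw [h8, up]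
      convert h9 using 1
      abel

/-- A point of the second level that enters the first after `i` iterations of `T^n` has its class
increased by exactly `(n * i, 0)`. -/
theorem IsErgodic.exists_class [Countable G] [MeasurableSpace G] [DiscreteMeasurableSpace G]
    {n : ℕ} (he : IsErgodic (μ F) (T F)^[n])
    (hH : ∀ M ≥ N, ∀ i < γ F M, vec F M i - vec F M 0 ∈ H) {M : ℕ} (hM : N ≤ M)
    {z z' : ℤ × G} (hz : Valid F M z) (hz' : Valid F M z') :
    ∃ i : ℕ, (z ≠ z' → 0 < i) ∧ z - z' - (((n * i : ℕ) : ℤ), 0) ∈ H := by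
  obtain ⟨i, hi⟩ := he _ _ (measurableSet_lev F M z) (measurableSet_lev F M z') (μ_lev_pos hz)
    (μ_lev_pos hz')
  obtain ⟨x, hx, hx'⟩ := nonempty_of_measure_ne_zero hi.ne'
  refine ⟨i, fun hne => Nat.pos_of_ne_zero ?_, ?_⟩
  · rintro rfl
    exact hne (eq_of_mem_lev hz hz' hx hx')
  · obtain ⟨M', hM', v, h1, h2, h3⟩ := T_iterate_class hH hM hz' hx' (n * i)
    rw [Function.iterate_mul] at h2
    have h4 := class_unique hH hM hM' hz h1 hx h2
    convert add_mem h4 h3 using 1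
    abel

end Invariant

section Necessity

variable [Countable G] [MeasurableSpace G] [DiscreteMeasurableSpace G] {F : ℕ → CutOp G}

theorem shiftsGenerate_of_isErgodic (he : IsErgodic (μ F) (T F)) : ShiftsGenerate F := by
  rw [ShiftsGenerate, eq_top_iff]
  intro b _
  have hv : ∀ b : G, Valid F 0 (0, b) := fun b => ⟨le_rfl, by simpa using height_pos F 0⟩
  -- The preimage under the projection to `G` forgets the integer coordinate, so the time `i` plays
  -- no role.
  obtain ⟨i, -, h⟩ := IsErgodic.exists_class (n := 1) (N := 0) (M := 0)
    (H := (AddSubgroup.closure {x : G | ∃ N i, i < γ F N ∧ x = g F N i - g F N 0}).comap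
      (AddMonoidHom.snd ℤ G)) he
    (fun M _ i hi => AddSubgroup.subset_closure ⟨M, i, hi, rfl⟩) le_rfl (hv b) (hv 0)
  simpa using h

theorem spanCondition_of_totallyErgodic (he : TotallyErgodic F) : SpanCondition F := by
  intro N
  change _ ∈ spanGroup F N
  have hH : ∀ M ≥ N, ∀ i < γ F M, vec F M i - vec F M 0 ∈ spanGroup F N :=
    fun M hM i hi => vec_sub_mem_spanGroup F hM hi
  have hv : Valid F N (0, 0) := ⟨le_rfl, by simpa using height_pos F N⟩
  have h0 := hv.child (lt_trans one_pos (one_lt_γ F N))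
  have h1 := hv.child (one_lt_γ F N)
  have hpos : 0 < pos F N 1 := by have := height_pos F N; rw [pos_succ]; omega
  -- Two distinct pieces of one level have the same class, so the travel time between them is a
  -- positive `n` with `(n, 0)` in the group.
  obtain ⟨n, hn, hn'⟩ := IsErgodic.exists_class (he 1 one_pos) hH (Nat.le_succ N) h1 h0
  have hn0 : 0 < n := hn fun h => by
    have := congrArg Prod.fst h
    simp only [vec, Prod.fst_add, pos] at this hpos
    simp at this hpos
    omega
  have hmem : ((n : ℤ), (0 : G)) ∈ spanGroup F N := by
    have := sub_mem (hH N le_rfl 1 (one_lt_γ F N)) hn'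
    simpa using this
  have hh : 1 < height F (N + 1) :=
    lt_of_le_of_lt (height_pos F N) (height_strictMono F N.lt_succ_self)
  -- `T^n` preserves classes, yet it connects two levels whose addresses differ by `(1, 0)`.
  obtain ⟨i, -, hi⟩ := IsErgodic.exists_class (he n hn0) hH (Nat.le_succ N)
    (z := (1, 0)) (z' := (0, 0)) ⟨by simp, by simpa using hh⟩ ⟨le_rfl, by simpa using height_pos F (N + 1)⟩
  convert add_mem hi (nsmul_mem hmem i) using 1
  ext <;> simp [mul_comm]

end Necessity

/-! ### Lebesgue density for cubes -/

section Density

open Filter Topology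

variable {d : ℕ}

/-- The half-open cube of side `w` with lowest corner `a`. -/
def cube (a : Fin d → ℝ) (w : ℝ) : Set (Fin d → ℝ) := Set.univ.pi fun l => Set.Ico (a l) (a l + w)

theorem mem_cube {a y : Fin d → ℝ} {w : ℝ} : y ∈ cube a w ↔ ∀ l, a l ≤ y l ∧ y l < a l + w := by
  simp [cube]

theorem measurableSet_cube (a : Fin d → ℝ) (w : ℝ) : MeasurableSet (cube a w) :=
  .univ_pi fun _ => measurableSet_Ico

theorem volume_cube (a : Fin d → ℝ) (w : ℝ) : volume (cube a w) = ENNReal.ofReal w ^ d := by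
  simp [cube, Real.volume_pi_Ico]

theorem preimage_add_cube (a b : Fin d → ℝ) (w : ℝ) :
    (b + ·) ⁻¹' cube (b + a) w = cube a w := by
  ext y; simp [mem_cube, add_assoc]

/-- A set of positive volume has a point at which it fills small cubes almost entirely. -/
theorem exists_density_point {C : Set (Fin d → ℝ)} (hC : MeasurableSet C) (h0 : 0 < volume C) :
    ∃ x ∈ C, ∀ ε : ENNReal, ε ≠ 0 → ∃ δ > 0, ∀ (w : ℝ) (a : Fin d → ℝ), 0 < w → w < δ →
      x ∈ cube a w → volume (cube a w \ C) ≤ ε * ENNReal.ofReal w ^ d := by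
  have hne : (ae (volume.restrict C)).NeBot :=
    ae_neBot.2 (by rw [Ne, Measure.restrict_eq_zero]; exact h0.ne')
  obtain ⟨x, hx, hxC⟩ := ((IsUnifLocDoublingMeasure.ae_tendsto_measure_inter_div
    (volume : Measure (Fin d → ℝ)) C 1).and (ae_restrict_mem hC)).exists
  refine ⟨x, hxC, fun ε hε => ?_⟩
  by_contra! hcon
  choose w a hw hwδ hxa hbad using fun n : ℕ => hcon (1 / ((n : ℝ) + 1)) (by positivity)
  have hlim : Tendsto (fun n => w n / 2) atTop (𝓝[>] 0) := by
    refine tendsto_nhdsWithin_iff.2 ⟨?_, .of_forall fun n => half_pos (hw n)⟩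
    refine squeeze_zero (fun n => (half_pos (hw n)).le) (fun n => ?_)
      tendsto_one_div_add_atTop_nhds_zero_nat
    linarith [hw n, hwδ n]
  have hball : ∀ n, Metric.closedBall (fun l => a n l + w n / 2) (w n / 2) =
      Set.univ.pi fun l => Set.Icc (a n l) (a n l + w n) := by
    intro n
    rw [closedBall_pi _ (half_pos (hw n)).le]
    congr 1
    ext1 l
    rw [Real.closedBall_eq_Icc]
    congr 1 <;> ring
  have hsub : ∀ n, cube (a n) (w n) ⊆
      Metric.closedBall (fun l => a n l + w n / 2) (w n / 2) := by
    intro n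
    rw [hball]
    exact Set.pi_mono fun l _ => Set.Ico_subset_Icc_self
  have hvol : ∀ n, volume (Metric.closedBall (fun l => a n l + w n / 2) (w n / 2)) =
      ENNReal.ofReal (w n) ^ d := by
    intro n
    rw [hball, volume_pi_pi]
    simp
  -- Closed balls of the sup norm are cubes. They need not be centred at `x`: with constant `1` it
  -- is enough that they contain it.
  have hT := hx (fun n l => a n l + w n / 2) (fun n => w n / 2) hlim
    (.of_forall fun n => by rw [one_mul]; exact hsub n (hxa n))
  have hle : ∀ n, volume (C ∩ Metric.closedBall (fun l => a n l + w n / 2) (w n / 2)) /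
      volume (Metric.closedBall (fun l => a n l + w n / 2) (w n / 2)) + ε ≤ 1 := by
    intro n
    have hp : ENNReal.ofReal (w n) ^ d ≠ 0 := pow_ne_zero _ (by simpa using hw n)
    have hf : ENNReal.ofReal (w n) ^ d ≠ ⊤ := ENNReal.pow_ne_top ENNReal.ofReal_ne_top
    have h1 : ε ≤ volume (Metric.closedBall (fun l => a n l + w n / 2) (w n / 2) \ C) /
        ENNReal.ofReal (w n) ^ d := by
      rw [ENNReal.le_div_iff_mul_le (.inl hp) (.inl hf)]
      exact (hbad n).le.trans (measure_mono (Set.sdiff_subset_sdiff_left (hsub n)))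
    rw [hvol]
    refine (add_le_add_right h1 _).trans ?_
    rw [ENNReal.div_add_div_same, Set.inter_comm, measure_inter_add_sdiff _ hC, hvol,
      ENNReal.div_self hp hf]
  have h2 := le_of_tendsto (hT.add_const ε) (.of_forall hle)
  exact absurd h2 (not_le.2 (ENNReal.lt_add_right ENNReal.one_ne_top hε))

theorem inter_volume_pos {Q S S' : Set (Fin d → ℝ)} (h : volume (Q \ S) + volume (Q \ S') < volume Q) :
    0 < volume (S ∩ S') := by
  by_contra! h0
  have h1 : Q ⊆ (Q \ S) ∪ (Q \ S') ∪ (S ∩ S') := by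
    intro x hx
    by_cases h2 : x ∈ S <;> by_cases h3 : x ∈ S' <;> simp [hx, h2, h3]
  have h2 := (measure_mono h1).trans (measure_union_le (μ := volume) _ _)
  have h3 := h2.trans (add_le_add_left (measure_union_le (μ := volume) _ _) _)
  rw [nonpos_iff_eq_zero.1 h0, add_zero] at h3
  exact absurd h (not_lt.2 h3)

end Density

/-! ### Overlaps in products of levels -/

section Pull

variable {d : ℕ}

/-- The part of `A` in the product of the levels with the addresses `z l`, translated to a cube
with lowest corner at the origin. -/
def pull (F : ℕ → CutOp G) (A : Set (Fin d → ℝ × G)) (N : ℕ) (z : Fin d → ℤ × G) :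
    Set (Fin d → ℝ) :=
  cube 0 (width F N) ∩ (fun y l => point F N (z l) (y l)) ⁻¹' A

theorem pull_desc {F : ℕ → CutOp G} {A : Set (Fin d → ℝ × G)} {N : ℕ} {z : Fin d → ℤ × G}
    (hz : ∀ l, Valid F N (z l)) (r : ℕ) (p : Fin d → ℕ) :
    pull F A (N + r) (fun l => z l + desc F r N (p l)) =
      cube 0 (width F (N + r)) ∩ ((fun l => offset F r N (p l)) + ·) ⁻¹' pull F A N z := by
  ext y
  simp only [pull, Set.mem_inter_iff, Set.mem_preimage, and_congr_right_iff]
  intro hy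
  have h1 : (fun l => offset F r N (p l)) + y ∈ cube 0 (width F N) := by
    rw [mem_cube] at hy ⊢
    intro l
    have h2 := hy l
    have h3 := offset_nonneg F r N (p l)
    have h4 := offset_add_width_le F r N (p l)
    simp only [Pi.zero_apply, zero_add, Pi.add_apply] at h2 ⊢
    exact ⟨by linarith, by linarith⟩
  simp only [h1, true_and, point, entry_desc (hz _), Pi.add_apply, add_assoc]

/-- A set of positive volume in a cube almost fills one of the pieces of every late generation. -/
theorem exists_dense_piece (F : ℕ → CutOp G) {N : ℕ} {C : Set (Fin d → ℝ)} (hC : MeasurableSet C)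
    (hsub : C ⊆ cube 0 (width F N)) (h0 : 0 < volume C) {ε : ENNReal} (hε : ε ≠ 0) :
    ∃ K, ∀ r, K ≤ N + r → ∃ p : Fin d → ℕ,
      volume (cube 0 (width F (N + r)) \ ((fun l => offset F r N (p l)) + ·) ⁻¹' C) ≤
        ε * ENNReal.ofReal (width F (N + r)) ^ d := by
  obtain ⟨x, hx, h⟩ := exists_density_point hC h0
  obtain ⟨δ, hδ, h⟩ := h ε hε
  obtain ⟨K, hK⟩ := exists_width_lt F hδ
  refine ⟨K, fun r hr => ?_⟩
  have hxc := mem_cube.1 (hsub hx)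
  choose p hp using fun l => exists_offset F r N (hxc l).1 (by simpa using (hxc l).2)
  refine ⟨p, le_of_eq_of_le ?_
    (h (width F (N + r)) (fun l => offset F r N (p l)) (width_pos F _) (hK _ hr) (mem_cube.2 hp))⟩
  have h2 := preimage_add_cube 0 (fun l => offset F r N (p l)) (width F (N + r))
  rw [add_zero] at h2
  rw [← h2, ← Set.preimage_sdiff, measure_preimage_add]

variable [MeasurableSpace G] [DiscreteMeasurableSpace G]

theorem measurable_points (F : ℕ → CutOp G) (N : ℕ) (z : Fin d → ℤ × G) :
    Measurable fun (y : Fin d → ℝ) l => point F N (z l) (y l) :=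
  measurable_pi_lambda _ fun l => (measurable_point F N (z l)).comp (measurable_pi_apply l)

theorem measurableSet_pull (F : ℕ → CutOp G) {A : Set (Fin d → ℝ × G)} (hA : MeasurableSet A)
    (N : ℕ) (z : Fin d → ℤ × G) : MeasurableSet (pull F A N z) :=
  (measurableSet_cube _ _).inter (measurable_points F N z hA)

theorem restrict_pi_lev [Countable G] {F : ℕ → CutOp G} {N : ℕ} {z : Fin d → ℤ × G}
    (hz : ∀ l, Valid F N (z l)) :
    (Measure.pi fun _ : Fin d => μ F).restrict (Set.univ.pi fun l => lev F N (z l)) =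
      (volume.restrict (cube 0 (width F N))).map fun y l => point F N (z l) (y l) := by
  have : ∀ l, SigmaFinite ((volume.restrict (Set.Ico 0 (width F N))).map (point F N (z l))) :=
    fun l => by rw [← restrict_lev (hz l)]; infer_instance
  rw [Measure.restrict_pi_pi]
  simp_rw [restrict_lev (hz _)]
  rw [← Measure.pi_map_pi fun l => (measurable_point F N (z l)).aemeasurable, cube, volume_pi,
    Measure.restrict_pi_pi]
  simp

theorem measure_inter_pi_lev [Countable G] {F : ℕ → CutOp G} {N : ℕ} {z : Fin d → ℤ × G}
    (hz : ∀ l, Valid F N (z l)) {A : Set (Fin d → ℝ × G)} (hA : MeasurableSet A) :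
    (Measure.pi fun _ : Fin d => μ F) (A ∩ Set.univ.pi fun l => lev F N (z l)) =
      volume (pull F A N z) := by
  rw [← Measure.restrict_apply hA, restrict_pi_lev hz,
    Measure.map_apply (measurable_points F N z) hA,
    Measure.restrict_apply (measurable_points F N z hA), pull, Set.inter_comm]

theorem measurableSet_space [Countable G] (F : ℕ → CutOp G) : MeasurableSet (space F) := by
  have : space F = ⋃ N, ⋃ z : ℤ × G, ⋃ _ : Valid F N z, lev F N z := by
    ext x
    simp only [Set.mem_iUnion]
    constructor
    · intro hx
      obtain ⟨N, h⟩ := exists_mem_lev hx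
      obtain ⟨z, hz, hxz⟩ := h N le_rfl
      exact ⟨N, z, hz, hxz⟩
    · rintro ⟨N, z, hz, hxz⟩
      exact lev_subset_space hz hxz
  rw [this]
  exact .iUnion fun N => .iUnion fun z => .iUnion fun _ => measurableSet_lev F N z

theorem exists_pull_pos [Countable G] (F : ℕ → CutOp G) {A : Set (Fin d → ℝ × G)}
    (hA : MeasurableSet A) (h0 : 0 < (Measure.pi fun _ : Fin d => μ F) A) :
    ∃ N z, (∀ l, Valid F N (z l)) ∧ 0 < volume (pull F A N z) := by
  by_contra! hcon
  have h1 : ∀ᵐ x ∂(Measure.pi fun _ : Fin d => μ F), ∀ l, x l ∈ space F := by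
    rw [ae_all_iff]
    intro l
    exact Measure.tendsto_eval_ae_ae (ae_restrict_mem (measurableSet_space F))
  have h2 : ∀ᵐ x ∂(Measure.pi fun _ : Fin d => μ F), ∀ (N : ℕ) (z : Fin d → ℤ × G),
      (∀ l, Valid F N (z l)) → ¬ (x ∈ A ∩ Set.univ.pi fun l => lev F N (z l)) := by
    rw [ae_all_iff]; intro N
    rw [ae_all_iff]; intro z
    by_cases hz : ∀ l, Valid F N (z l)
    · simp only [hz, implies_true, true_implies]
      refine measure_eq_zero_iff_ae_notMem.1 ?_
      rw [measure_inter_pi_lev hz hA]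
      exact nonpos_iff_eq_zero.1 (hcon N z hz)
    · exact .of_forall fun x h => absurd h hz
  refine h0.ne' (measure_eq_zero_iff_ae_notMem.2 ?_)
  filter_upwards [h1, h2] with x hx hx' hxA
  choose n hn using fun l => exists_mem_lev (hx l)
  choose z hz hxz using fun l => hn l (Finset.univ.sup n) (Finset.le_sup (Finset.mem_univ l))
  exact hx' _ z hz ⟨hxA, fun l _ => hxz l⟩

/-- There are products of levels of generation `N` whose addresses differ by `v` and which contain
parts of `A` and of `B` that overlap after translation. -/
def Meets (F : ℕ → CutOp G) (A B : Set (Fin d → ℝ × G)) (N : ℕ) (v : Fin d → ℤ × G) : Prop :=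
  ∃ z z' : Fin d → ℤ × G, (∀ l, Valid F N (z l)) ∧ (∀ l, Valid F N (z' l)) ∧
    z - z' = v ∧ 0 < volume (pull F A N z ∩ pull F B N z')

theorem add_lt_of_le_quarter {a b c : ENNReal} (h0 : c ≠ 0) (hc : c ≠ ⊤) (ha : a ≤ 4⁻¹ * c)
    (hb : b ≤ 4⁻¹ * c) : a + b < c := by
  refine lt_of_le_of_lt (add_le_add ha hb) ?_
  rw [← add_mul]
  conv_rhs => rw [← one_mul c]
  refine ENNReal.mul_lt_mul_left h0 hc ?_
  rw [← ENNReal.toReal_lt_toReal (by simp) (by simp), ENNReal.toReal_add (by simp) (by simp)]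
  norm_num

/-- At a common late generation each set fills all but a quarter of some product of levels;
translated to the same cube, the two must overlap. -/
theorem exists_meets [Countable G] (F : ℕ → CutOp G) {A B : Set (Fin d → ℝ × G)}
    (hA : MeasurableSet A) (hB : MeasurableSet B)
    (hA0 : 0 < (Measure.pi fun _ : Fin d => μ F) A)
    (hB0 : 0 < (Measure.pi fun _ : Fin d => μ F) B) : ∃ N v, Meets F A B N v := by
  obtain ⟨N, z, hz, h⟩ := exists_pull_pos F hA hA0
  obtain ⟨N', z', hz', h'⟩ := exists_pull_pos F hB hB0
  obtain ⟨K, hK⟩ := exists_dense_piece F (measurableSet_pull F hA N z) Set.inter_subset_left h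
    (ε := 4⁻¹) (by simp)
  obtain ⟨K', hK'⟩ := exists_dense_piece F (measurableSet_pull F hB N' z') Set.inter_subset_left h'
    (ε := 4⁻¹) (by simp)
  obtain ⟨p, hp⟩ := hK (N' + K + K') (by omega)
  obtain ⟨p', hp'⟩ := hK' (N + K + K') (by omega)
  have he : N' + (N + K + K') = N + (N' + K + K') := by omega
  have hv' := fun l => (hz' l).desc (N + K + K') (p' l)
  have hq := pull_desc (A := B) hz' (N + K + K') p'
  rw [he] at hp' hv' hq
  refine ⟨N + (N' + K + K'), _, _, _, fun l => (hz l).desc _ (p l), hv', rfl, ?_⟩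
  rw [pull_desc hz, hq]
  refine inter_volume_pos (Q := cube 0 (width F (N + (N' + K + K')))) ?_
  rw [Set.sdiff_self_inter, Set.sdiff_self_inter, volume_cube]
  exact add_lt_of_le_quarter (pow_ne_zero _ (by simpa using width_pos F _))
    (ENNReal.pow_ne_top ENNReal.ofReal_ne_top) hp hp'

theorem pieces_congr {F : ℕ → CutOp G} {M M' L : ℕ} (h : ∀ i < L, F (M + i) = F (M' + i)) :
    pieces F L M = pieces F L M' :=
  Finset.prod_congr rfl fun i hi => by rw [γ, γ, h i (Finset.mem_range.1 hi)]

/-- Late pieces can be chosen such that any two of their pieces still meet. -/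
theorem Meets.refine {F : ℕ → CutOp G} (hF : Recurrent F) {A B : Set (Fin d → ℝ × G)}
    (hA : MeasurableSet A) (hB : MeasurableSet B) {N : ℕ} {v : Fin d → ℤ × G}
    (h : Meets F A B N v) (n L K : ℕ) :
    ∃ M ≥ K, (∀ i < L, F (n + i) = F (M + i)) ∧ ∀ u u' : Fin d → ℕ,
      Meets F A B (M + L) fun l => v l + (desc F L M (u l) - desc F L M (u' l)) := by
  obtain ⟨z, z', hz, hz', rfl, h0⟩ := h
  have hP : (pieces F L n : ENNReal) ≠ 0 := by
    have := lt_pieces F L n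
    exact_mod_cast (by omega : pieces F L n ≠ 0)
  have hP' : (pieces F L n : ENNReal) ^ d ≠ ⊤ := ENNReal.pow_ne_top (ENNReal.natCast_ne_top _)
  -- If at most `1 / (4 P ^ d)` of a cube is missing, at most a quarter of each of its `P ^ d`
  -- subcubes is. The number `P` depends only on the operations of the block, so it is known before
  -- `M` is chosen.
  obtain ⟨K', hK'⟩ := exists_dense_piece F
    ((measurableSet_pull F hA N z).inter (measurableSet_pull F hB N z'))
    (Set.inter_subset_left.trans Set.inter_subset_left) h0
    (ε := 4⁻¹ * ((pieces F L n : ENNReal) ^ d)⁻¹) (mul_ne_zero (by simp) (ENNReal.inv_ne_zero.2 hP'))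
  obtain ⟨M, hM, hlt⟩ := (hF n L).exists_gt (N + K + K')
  obtain ⟨r, rfl⟩ := Nat.exists_eq_add_of_le (show N ≤ M by omega)
  refine ⟨N + r, by omega, hM, fun u u' => ?_⟩
  obtain ⟨p, hp⟩ := hK' r (by omega)
  have hw : ENNReal.ofReal (width F (N + r)) =
      pieces F L n * ENNReal.ofReal (width F (N + r + L)) := by
    rw [pieces_congr hM, ← ENNReal.ofReal_natCast, ← ENNReal.ofReal_mul (Nat.cast_nonneg _),
      pieces_mul_width]
  rw [hw, mul_pow, mul_assoc 4⁻¹, ← mul_assoc (_ ^ d)⁻¹, ENNReal.inv_mul_cancel (pow_ne_zero _ hP) hP',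
    one_mul] at hp
  -- The same piece `p` is taken for `A` and `B`, so the address difference is still `v` before the
  -- block; inside it, every subpiece is filled up to a quarter, whatever its index.
  have key : ∀ (C : Set (Fin d → ℝ × G)) (y : Fin d → ℤ × G) (q : Fin d → ℕ),
      (∀ l, Valid F N (y l)) → pull F A N z ∩ pull F B N z' ⊆ pull F C N y →
      volume (cube 0 (width F (N + r + L)) \
        pull F C (N + r + L) (fun l => y l + desc F r N (p l) + desc F L (N + r) (q l))) ≤
        4⁻¹ * ENNReal.ofReal (width F (N + r + L)) ^ d := by
    intro C y q hy hsub
    refine le_trans ?_ hp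
    rw [pull_desc (fun l => (hy l).desc r (p l)), Set.sdiff_self_inter,
      ← measure_preimage_add volume (fun l => offset F L (N + r) (q l))
        (cube 0 (width F (N + r)) \ _)]
    refine measure_mono ?_
    rintro x ⟨h1, h2⟩
    have h3 : (fun l => offset F L (N + r) (q l)) + x ∈ cube 0 (width F (N + r)) := by
      rw [mem_cube] at h1 ⊢
      intro l
      have h2 := h1 l
      have h3 := offset_nonneg F L (N + r) (q l)
      have h4 := offset_add_width_le F L (N + r) (q l)
      simp only [Pi.zero_apply, zero_add, Pi.add_apply] at h2 ⊢
      exact ⟨by linarith, by linarith⟩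
    refine ⟨h3, fun h4 => h2 ?_⟩
    rw [Set.mem_preimage, pull_desc hy]
    exact ⟨h3, hsub h4⟩
  refine ⟨_, _, fun l => ((hz l).desc r (p l)).desc L (u l),
    fun l => ((hz' l).desc r (p l)).desc L (u' l), ?_, ?_⟩
  · funext l
    simp only [Pi.sub_apply]
    abel
  · refine inter_volume_pos (Q := cube 0 (width F (N + r + L))) ?_
    rw [volume_cube]
    exact add_lt_of_le_quarter (pow_ne_zero _ (by simpa using width_pos F _))
      (ENNReal.pow_ne_top ENNReal.ofReal_ne_top) (key A z u hz Set.inter_subset_left)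
      (key B z' u' hz' Set.inter_subset_right)

theorem iterate_pi_apply {ι X : Type*} (f : ι → X → X) (n : ℕ) (x : ι → X) :
    (fun (x : ι → X) i => f i (x i))^[n] x = fun i => (f i)^[n] (x i) := by
  induction n with
  | zero => rfl
  | succ n ih => rw [Function.iterate_succ_apply', ih]; simp only [Function.iterate_succ_apply']

/-- The `n`-th iterate carries the product at `z'` onto that at `z` by translation, so the overlap
of the two pulled-back sets survives as a subset of the return set. -/
theorem Meets.measure_pos [Countable G] {F : ℕ → CutOp G} {A B : Set (Fin d → ℝ × G)} {N n : ℕ}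
    {k : Fin d → ℤ} (h : Meets F A B N fun l => (k l * n, 0)) :
    0 < (Measure.pi fun _ : Fin d => μ F)
      ((fun x l => Tpow F (k l) (x l))^[n] ⁻¹' A ∩ B) := by
  obtain ⟨z, z', hz, hz', hv, h0⟩ := h
  have hzl : ∀ l, z l = z' l + (k l * n, 0) := fun l => by
    rw [← congrFun hv l]; simp
  have h1 := Measure.le_map_apply (measurable_points F N z').aemeasurable
    (μ := volume.restrict (cube 0 (width F N)))
    ((fun x l => Tpow F (k l) (x l))^[n] ⁻¹' A ∩ B)
  rw [← restrict_pi_lev hz'] at h1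
  refine lt_of_lt_of_le h0 (le_trans ?_ (h1.trans (Measure.restrict_apply_le _ _)))
  refine le_trans (measure_mono ?_) (Measure.le_restrict_apply _ _)
  rintro y ⟨⟨hy, hyA⟩, -, hyB⟩
  refine ⟨⟨?_, hyB⟩, hy⟩
  change (fun x l => Tpow F (k l) (x l))^[n] _ ∈ A
  rw [iterate_pi_apply]
  refine (congrArg (· ∈ A) (funext fun l => ?_)).mpr hyA
  change _ = point F N (z l) (y l)
  rw [hzl l]
  refine Tpow_iterate_point (hz' l) (by rw [← hzl]; exact hz l) ?_
  have := mem_cube.1 hy l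
  simpa using this

end Pull

/-! ### Displacements between consecutive copies of a column -/

theorem γ_congr {F : ℕ → CutOp G} {M M' : ℕ} (h : F M = F M') : γ F M = γ F M' := by
  rw [γ, γ, h]

theorem s_congr {F : ℕ → CutOp G} {M M' : ℕ} (h : F M = F M') (i : ℕ) : s F M i = s F M' i := by
  rw [s, s, h]

theorem g_congr {F : ℕ → CutOp G} {M M' : ℕ} (h : F M = F M') (i : ℕ) : g F M i = g F M' i := by
  rw [g, g, h]

theorem t_sub_t {F : ℕ → CutOp G} {M M' : ℕ} (h : F M = F M') (i : ℕ) :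
    t F M' i - t F M i = ((height F M' : ℤ) - height F M, 0) := by
  simp only [t, s_congr h, g_congr h, Prod.mk_sub_mk, sub_self, add_sub_add_left_eq_sub]

theorem c_congr {F : ℕ → CutOp G} {M M' : ℕ} (h : F M = F M') (h' : F (M + 1) = F (M' + 1))
    (i : ℕ) : c F M i = c F M' i := by
  simp only [c, s_congr h, g_congr h, s_congr h', g_congr h', γ_congr h]

theorem div_γ_lt {F : ℕ → CutOp G} {M p : ℕ} (h : ¬ p % γ F M + 1 < γ F M) :
    p / γ F M < p := by
  have h1 := one_lt_γ F M
  refine Nat.div_lt_self (Nat.pos_of_ne_zero ?_) h1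
  rintro rfl
  simp at h
  omega

/-- The difference between the displacement from the `p`-th to the `p + 1`-st copy of a column of
generation `M` in a later column and `t_{M,0}`. -/
def step (F : ℕ → CutOp G) (M p : ℕ) : ℤ × G :=
  if h : p % γ F M + 1 < γ F M then t F M (p % γ F M) - t F M 0
  else
    have := div_γ_lt h
    c F M 0 + step F (M + 1) (p / γ F M)
termination_by p

theorem step_of_lt {F : ℕ → CutOp G} {M p : ℕ} (h : p % γ F M + 1 < γ F M) :
    step F M p = t F M (p % γ F M) - t F M 0 := by
  rw [step, dif_pos h]

theorem step_carry (F : ℕ → CutOp G) (M p : ℕ) :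
    step F M (γ F M - 1 + γ F M * p) = c F M 0 + step F (M + 1) p := by
  have h := one_lt_γ F M
  have h1 : (γ F M - 1 + γ F M * p) % γ F M = γ F M - 1 := by
    rw [Nat.add_mul_mod_self_left, Nat.mod_eq_of_lt (by omega)]
  have h2 : (γ F M - 1 + γ F M * p) / γ F M = p := by
    rw [Nat.add_mul_div_left _ _ (by omega), Nat.div_eq_of_lt (by omega), zero_add]
  rw [step, dif_neg (by rw [h1]; omega)]
  simp only [h2]

theorem eq_carry {F : ℕ → CutOp G} {M p : ℕ} (h : ¬ p % γ F M + 1 < γ F M) :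
    p = γ F M - 1 + γ F M * (p / γ F M) := by
  have h1 := Nat.mod_add_div p (γ F M)
  have h2 := Nat.mod_lt p (lt_trans one_pos (one_lt_γ F M))
  omega

theorem step_zero (F : ℕ → CutOp G) (M : ℕ) : step F M 0 = 0 := by
  rw [step_of_lt (by simpa using one_lt_γ F M)]; simp

/-- Heights cancel in `t F M i - t F M 0` and do not occur in `c`. As dividing by `γ` decreases `p`
at each carry, only the operations up to `M + p + 1` are consulted. -/
theorem step_congr {F : ℕ → CutOp G} {L p : ℕ} :
    ∀ {M M' : ℕ}, (∀ i < L, F (M + i) = F (M' + i)) → p + 1 < L → step F M p = step F M' p := by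
  induction p using Nat.strong_induction_on generalizing L with
  | _ p ih =>
  intro M M' h hp
  have h0 : F M = F M' := h 0 (by omega)
  have h1 : F (M + 1) = F (M' + 1) := h 1 (by omega)
  by_cases hc : p % γ F M + 1 < γ F M
  · have hc' : p % γ F M' + 1 < γ F M' := by rwa [γ_congr h0] at hc
    rw [step_of_lt hc, step_of_lt hc', γ_congr h0, sub_eq_sub_iff_sub_eq_sub,
      t_sub_t h0.symm, t_sub_t h0.symm]
  · have hlt := div_γ_lt hc
    conv_lhs => rw [eq_carry hc, step_carry]
    have hc' : ¬ p % γ F M' + 1 < γ F M' := by rwa [γ_congr h0] at hc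
    conv_rhs => rw [eq_carry hc', step_carry]
    rw [c_congr h0 h1, ← γ_congr h0, ih _ hlt (L := L - 1) (M := M + 1) (M' := M' + 1)
      (fun i hi => by simpa [add_assoc, add_comm 1] using h (i + 1) (by omega)) (by omega)]

/-- Adding one to `p` in the mixed radix expansion either raises the last digit, or resets it and
carries; `t_succ` turns the carry into `c F M 0` and the step of the next generation. -/
theorem desc_succ_sub {F : ℕ → CutOp G} {r M p : ℕ} (hp : p + 1 < pieces F r M) :
    desc F r M (p + 1) - desc F r M p = t F M 0 + step F M p := by
  induction r generalizing M p with
  | zero => simp [pieces] at hp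
  | succ r ih =>
    have h1 := one_lt_γ F M
    rw [desc, desc]
    by_cases hc : p % γ F M + 1 < γ F M
    · have h2 := Nat.mod_add_div p (γ F M)
      have h3 : (p + 1) % γ F M = p % γ F M + 1 := by
        conv_lhs => rw [← h2, add_right_comm, Nat.add_mul_mod_self_left, Nat.mod_eq_of_lt hc]
      have h4 : (p + 1) / γ F M = p / γ F M := by
        conv_lhs => rw [← h2, add_right_comm, Nat.add_mul_div_left _ _ (by omega),
          Nat.div_eq_of_lt hc, zero_add]
      rw [h3, h4, step_of_lt hc, ← vec_succ_sub F M (p % γ F M)]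
      abel
    · have h2 := eq_carry hc
      generalize p / γ F M = p' at h2 ⊢
      subst h2
      have h3 : γ F M - 1 + γ F M * p' + 1 = γ F M * (p' + 1) := by
        rw [mul_add]; omega
      have h4 : (γ F M - 1 + γ F M * p') % γ F M = γ F M - 1 := by
        rw [Nat.add_mul_mod_self_left, Nat.mod_eq_of_lt (by omega)]
      rw [h3, pieces_succ] at hp
      have h5 := ih (Nat.lt_of_mul_lt_mul_left hp)
      rw [step_carry, h3, h4, Nat.mul_mod_right, Nat.mul_div_cancel_left _ (by omega),
        ← sub_add_cancel (desc F r (M + 1) (p' + 1)) (desc F r (M + 1) p'), h5, t_succ]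
      abel

theorem desc_sub_desc_zero {F : ℕ → CutOp G} {L M x : ℕ} (hx : x < L) :
    desc F L M x - desc F L M 0 = x • t F M 0 + ∑ p ∈ Finset.range x, step F M p := by
  rw [← Finset.sum_range_sub, ← Finset.card_range x, ← Finset.sum_const, Finset.card_range,
    ← Finset.sum_add_distrib]
  refine Finset.sum_congr rfl fun p hp => desc_succ_sub ?_
  have := Finset.mem_range.1 hp
  have := lt_pieces F L M
  omega

/-- The displacements in blocks with the same operations differ by a multiple of the difference of
heights. -/
theorem desc_sub_desc {F : ℕ → CutOp G} {L M M' x y : ℕ} (h : ∀ i < L, F (M + i) = F (M' + i))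
    (hx : x < L) (hy : y < L) :
    desc F L M' x - desc F L M' y = desc F L M x - desc F L M y +
      (((x : ℤ) - y) * ((height F M' : ℤ) - height F M), 0) := by
  have key : ∀ x < L, desc F L M' x - desc F L M' 0 = desc F L M x - desc F L M 0 +
      ((x : ℤ) * ((height F M' : ℤ) - height F M), 0) := by
    intro x hx
    rw [desc_sub_desc_zero hx, desc_sub_desc_zero hx, ← sub_eq_iff_eq_add']
    have h1 : ∑ p ∈ Finset.range x, step F M p = ∑ p ∈ Finset.range x, step F M' p :=
      Finset.sum_congr rfl fun p hp => step_congr h (by have := Finset.mem_range.1 hp; omega)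
    rw [h1, add_sub_add_right_eq_sub, ← smul_sub, t_sub_t (M := M) (M' := M') (h 0 (by omega))]
    ext <;> simp
  have h2 : (((x : ℤ) - y) * ((height F M' : ℤ) - height F M), (0 : G)) =
      ((x : ℤ) * ((height F M' : ℤ) - height F M), 0) -
      ((y : ℤ) * ((height F M' : ℤ) - height F M), 0) := by
    ext
    · simp only [Prod.fst_sub]; ring
    · simp
  rw [h2, ← sub_sub_sub_cancel_right _ _ (desc F L M' 0), key x hx, key y hy]
  abel

/-! ### The quotient by the group of the vectors `c_{M,i}` -/

/-- The group generated by the vectors `c_{M,i}`. -/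
def cGroup (F : ℕ → CutOp G) : AddSubgroup (ℤ × G) :=
  AddSubgroup.closure {v | ∃ M i, i + 2 ≤ γ F (M + 1) ∧ v = c F M i}

theorem c_mem_cGroup {F : ℕ → CutOp G} {M i : ℕ} (h : i + 2 ≤ γ F (M + 1)) :
    c F M i ∈ cGroup F := AddSubgroup.subset_closure ⟨M, i, h, rfl⟩

theorem t_succ_sub_t_succ (F : ℕ → CutOp G) (M i : ℕ) :
    t F (M + 1) i - t F (M + 1) 0 = c F M i - c F M 0 := by
  rw [t_succ, t_succ F M 0]; abel

theorem t_sub_mem_cGroup {F : ℕ → CutOp G} (hF : Recurrent F) {N i : ℕ} (hi : i + 2 ≤ γ F N) :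
    t F N i - t F N 0 ∈ cGroup F := by
  obtain ⟨M, hM, hlt⟩ := (hF N 1).exists_gt 0
  obtain ⟨M, rfl⟩ := Nat.exists_eq_add_of_lt hlt
  have h : F N = F (0 + M + 1) := hM 0 one_pos
  rw [zero_add] at h
  -- Recurrence replaces `N`, which may be `0`, by a successor, where the difference is one of two
  -- vectors `c`.
  have h1 : t F N i - t F N 0 = t F (M + 1) i - t F (M + 1) 0 := by
    rw [sub_eq_sub_iff_sub_eq_sub, t_sub_t h.symm, t_sub_t h.symm]
  rw [h1, t_succ_sub_t_succ]
  rw [γ_congr h] at hi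
  exact sub_mem (c_mem_cGroup hi) (c_mem_cGroup (one_lt_γ F _))

theorem step_mem_cGroup {F : ℕ → CutOp G} (hF : Recurrent F) (M p : ℕ) :
    step F M p ∈ cGroup F := by
  induction p using Nat.strong_induction_on generalizing M with
  | _ p ih =>
  by_cases hc : p % γ F M + 1 < γ F M
  · rw [step_of_lt hc]
    exact t_sub_mem_cGroup hF hc
  · have h1 := ih _ (div_γ_lt hc) (M + 1)
    rw [eq_carry hc, step_carry]
    exact add_mem (c_mem_cGroup (one_lt_γ F _)) h1

theorem desc_sub_sub_mem_cGroup {F : ℕ → CutOp G} (hF : Recurrent F) {L M x : ℕ} (hx : x < L) :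
    desc F L M x - desc F L M 0 - x • t F M 0 ∈ cGroup F := by
  rw [desc_sub_desc_zero hx, add_sub_cancel_left]
  exact sum_mem fun p _ => step_mem_cGroup hF M p

theorem t_succ_sub_smul_mem_cGroup {F : ℕ → CutOp G} (hF : Recurrent F) (M : ℕ) :
    t F (M + 1) 0 - γ F M • t F M 0 ∈ cGroup F := by
  have h := one_lt_γ F M
  have h1 : t F (M + 1) 0 - γ F M • t F M 0 =
      ∑ k ∈ Finset.range (γ F M - 1), (t F M k - t F M 0) + c F M 0 := by
    rw [t_succ, vec_sub_vec_zero, Finset.sum_sub_distrib, Finset.sum_const, Finset.card_range]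
    obtain ⟨n, hn⟩ := Nat.exists_eq_add_of_lt h
    rw [hn, Nat.add_sub_cancel, succ_nsmul]
    abel
  rw [h1]
  refine add_mem (sum_mem fun k hk => t_sub_mem_cGroup hF ?_) (c_mem_cGroup (one_lt_γ F _))
  have := Finset.mem_range.1 hk
  omega

theorem spanGroup_eq_top {F : ℕ → CutOp G} (hF : Recurrent F) (h1 : ShiftsGenerate F)
    (h2 : SpanCondition F) (N : ℕ) : spanGroup F N = ⊤ := by
  have h3 : ((1, 0) : ℤ × G) ∈ spanGroup F N := h2 N
  have h4 : (spanGroup F N).map (AddMonoidHom.snd ℤ G) = ⊤ := by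
    rw [eq_top_iff, ← h1, AddSubgroup.closure_le]
    rintro _ ⟨M, i, hi, rfl⟩
    obtain ⟨M', hM', hlt⟩ := (hF M 1).exists_gt N
    have h : F M = F M' := hM' 0 one_pos
    rw [γ_congr h] at hi
    exact ⟨_, vec_sub_mem_spanGroup F hlt.le hi, by simp [vec, g_congr h]⟩
  rw [eq_top_iff]
  rintro ⟨a, b⟩ -
  obtain ⟨⟨a', b'⟩, h5, h6⟩ : b ∈ (spanGroup F N).map (AddMonoidHom.snd ℤ G) := h4 ▸ trivial
  obtain rfl : b' = b := h6
  convert add_mem h5 (zsmul_mem h3 (a - a')) using 1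
  ext <;> simp

theorem exists_sub_zsmul_mem_cGroup {F : ℕ → CutOp G} (hF : Recurrent F) {N : ℕ}
    (h : spanGroup F N = ⊤) (x : ℤ × G) : ∃ m : ℤ, x - m • t F N 0 ∈ cGroup F := by
  have hx : x ∈ spanGroup F N := h ▸ trivial
  induction hx using AddSubgroup.closure_induction with
  | mem x hx =>
    rcases hx with ⟨i, hi, rfl⟩ | ⟨M, i, hi, rfl⟩
    · exact ⟨1, by rw [one_smul]; exact t_sub_mem_cGroup hF hi⟩
    · exact ⟨0, by rw [zero_smul, sub_zero]; exact c_mem_cGroup hi⟩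
  | zero => exact ⟨0, by simp [zero_mem]⟩
  | add x y _ _ hx hy =>
    obtain ⟨m, hm⟩ := hx
    obtain ⟨n, hn⟩ := hy
    exact ⟨m + n, by convert add_mem hm hn using 1; rw [add_smul]; abel⟩
  | neg x _ hx =>
    obtain ⟨m, hm⟩ := hx
    exact ⟨-m, by convert neg_mem hm using 1; rw [neg_smul]; abel⟩

/-- Modulo `cGroup F`, `t F 0 0` is `m • t F 1 0` for some integer `m`, and `t F 1 0` is `γ F 0 • t
F 0 0`. So `1 - m * γ F 0` kills the generator `t F 0 0` of the quotient; it is nonzero because `γ F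
0 > 1`. -/
theorem exists_smul_mem_cGroup {F : ℕ → CutOp G} (hF : Recurrent F)
    (h : ∀ N, spanGroup F N = ⊤) : ∃ q : ℕ, 0 < q ∧ ∀ x : ℤ × G, q • x ∈ cGroup F := by
  obtain ⟨m, hm⟩ := exists_sub_zsmul_mem_cGroup hF (h 1) (t F 0 0)
  have h1 := t_succ_sub_smul_mem_cGroup hF 0
  have h2 : (1 - m * γ F 0 : ℤ) • t F 0 0 ∈ cGroup F := by
    convert add_mem hm (zsmul_mem h1 m) using 1
    rw [zero_add, smul_sub, sub_smul, mul_smul, one_smul, natCast_zsmul]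
    abel
  have h3 : ∀ x, (1 - m * γ F 0 : ℤ) • x ∈ cGroup F := by
    intro x
    obtain ⟨a, ha⟩ := exists_sub_zsmul_mem_cGroup hF (h 0) x
    convert add_mem (zsmul_mem ha (1 - m * γ F 0 : ℤ)) (zsmul_mem h2 a) using 1
    rw [smul_sub, smul_comm a]
    abel
  refine ⟨(1 - m * γ F 0 : ℤ).natAbs, Int.natAbs_pos.2 fun h0 => ?_, fun x => ?_⟩
  · have h4 : (γ F 0 : ℤ) ∣ 1 := ⟨m, by linarith⟩
    have h5 := Int.eq_one_of_dvd_one (by simp) h4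
    have := one_lt_γ F 0
    omega
  · rw [← natCast_zsmul]
    rcases Int.natAbs_eq (1 - m * γ F 0 : ℤ) with h4 | h4
    · rw [← h4]; exact h3 x
    · have := neg_mem (h3 x)
      rwa [h4, neg_smul, neg_neg] at this

/-! ### Differences of steps at distances divisible by `k` -/

/-- The group generated by the differences of steps at distances divisible by `k`. -/
def periodGroup (F : ℕ → CutOp G) (k : ℕ) : AddSubgroup (ℤ × G) :=
  AddSubgroup.closure {v | ∃ M p K, 0 < K ∧ k ∣ K ∧ v = step F M (p + K) - step F M p}

theorem exists_step_mem (F : ℕ → CutOp G) (W : AddSubgroup (ℤ × G)) {k : ℕ} (hk : 0 < k) :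
    ∀ M, (∀ p K, k ∣ K → step F M (p + K) - step F M p ∈ W) →
      ∃ M', ∀ p, step F M' p ∈ W := by
  induction k using Nat.strong_induction_on with
  | _ k ih =>
  intro M h
  have hγ := one_lt_γ F M
  -- If `γ F M` divides `k`, the positions with a carry reproduce the hypothesis one generation
  -- later with the smaller number `k / γ F M`. Otherwise a shift by `k` takes each carry to a fixed
  -- last digit without carry, so the steps of generation `M + 1` are constant modulo `W`, and
  -- `step_zero` makes the constant zero.
  by_cases hd : γ F M ∣ k
  · obtain ⟨k', rfl⟩ := hd
    have hk' : 0 < k' := Nat.pos_of_mul_pos_left hk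
    refine ih k' (by nlinarith) hk' (M + 1) fun p K hK => ?_
    have h1 := h (γ F M - 1 + γ F M * p) (γ F M * K) (Nat.mul_dvd_mul_left _ hK)
    rwa [add_assoc, ← mul_add, step_carry, step_carry, add_sub_add_left_eq_sub] at h1
  · refine ⟨M + 1, fun p => ?_⟩
    have hlt : (γ F M - 1 + k) % γ F M + 1 < γ F M := by
      have h1 := Nat.mod_lt (γ F M - 1 + k) (lt_trans one_pos hγ)
      by_contra hcon
      have h2 := eq_carry hcon
      exact hd ⟨(γ F M - 1 + k) / γ F M, by omega⟩
    have key : ∀ p, c F M 0 + step F (M + 1) p -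
        (t F M ((γ F M - 1 + k) % γ F M) - t F M 0) ∈ W := by
      intro p
      have h1 := neg_mem (h (γ F M - 1 + γ F M * p) k dvd_rfl)
      have h2 : (γ F M - 1 + γ F M * p + k) % γ F M = (γ F M - 1 + k) % γ F M := by
        rw [add_right_comm, Nat.add_mul_mod_self_left]
      rwa [step_carry, step_of_lt (by rwa [h2]), h2, neg_sub] at h1
    have h3 := sub_mem (key p) (key 0)
    rw [step_zero] at h3
    convert h3 using 1
    abel

theorem cGroup_le_periodGroup {F : ℕ → CutOp G} (hF : Recurrent F) {k : ℕ} (hk : 0 < k) :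
    cGroup F ≤ periodGroup F k := by
  obtain ⟨M', hM'⟩ := exists_step_mem F (periodGroup F k) hk 0 fun p K hK => by
    rcases Nat.eq_zero_or_pos K with rfl | h
    · simp [zero_mem]
    · exact AddSubgroup.subset_closure ⟨0, p, K, h, hK, rfl⟩
  have hall : ∀ M ≥ M', ∀ p, step F M p ∈ periodGroup F k := by
    intro M hM
    induction M, hM using Nat.le_induction with
    | base => exact hM'
    | succ M _ ih =>
      intro p
      have h1 := sub_mem (ih (γ F M - 1 + γ F M * p)) (ih (γ F M - 1 + γ F M * 0))
      rwa [step_carry, step_carry, step_zero, add_zero, add_sub_cancel_left] at h1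
  rw [cGroup, AddSubgroup.closure_le]
  rintro _ ⟨M, i, hi, rfl⟩
  obtain ⟨m, hm, hlt⟩ := (hF M 2).exists_gt M'
  have h0 : F M = F m := hm 0 two_pos
  have h1 : F (M + 1) = F (m + 1) := hm 1 one_lt_two
  rw [γ_congr h1] at hi
  -- At this position, one carry followed by last digit `i`, the step is exactly `c F m i`.
  have h2 := hall m hlt.le (γ F m - 1 + γ F m * i)
  have h3 : i % γ F (m + 1) = i := Nat.mod_eq_of_lt (by omega)
  rw [step_carry, step_of_lt (by rw [h3]; omega), h3, t_succ_sub_t_succ, add_sub_cancel] at h2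
  rw [SetLike.mem_coe, c_congr h0 h1]
  exact h2

/-! ### Sufficiency of the conditions -/

/-- The group of all vectors whose addition and subtraction preserve a property. -/
def translates {V : Type*} [AddCommGroup V] (P : V → Prop) : AddSubgroup V where
  carrier := {x | ∀ v, (P v → P (v + x)) ∧ (P v → P (v - x))}
  zero_mem' v := by simp
  add_mem' {x y} hx hy v := by
    refine ⟨fun h => ?_, fun h => ?_⟩
    · rw [← add_assoc]; exact (hy _).1 ((hx _).1 h)
    · rw [← sub_sub]; exact (hy _).2 ((hx _).2 h)
  neg_mem' {x} hx v := by
    refine ⟨fun h => ?_, fun h => ?_⟩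
    · rw [← sub_eq_add_neg]; exact (hx v).2 h
    · rw [sub_neg_eq_add]; exact (hx v).1 h

theorem of_mem_translates {V : Type*} [AddCommGroup V] {P : V → Prop} {v : V}
    (hv : v ∈ translates P) (h : P v) : P 0 := by
  simpa using (hv v).2 h

section Sufficiency

variable {d : ℕ} [MeasurableSpace G] [DiscreteMeasurableSpace G] {F : ℕ → CutOp G}
  {A B : Set (Fin d → ℝ × G)}

/-- Products of levels that meet can be chosen with address differences in the group of the
`c_{M,i}`. -/
theorem Meets.exists_mem_cGroup (hF : Recurrent F) (hA : MeasurableSet A) (hB : MeasurableSet B)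
    (hT : ∀ N, spanGroup F N = ⊤) {N : ℕ} {v : Fin d → ℤ × G} (h : Meets F A B N v) :
    ∃ N v, Meets F A B N v ∧ ∀ l, v l ∈ cGroup F := by
  obtain ⟨q, hq, hqc⟩ := exists_smul_mem_cGroup hF hT
  obtain ⟨M, -, -, hM⟩ := h.refine hF hA hB 0 q 0
  choose m hm using fun l => exists_sub_zsmul_mem_cGroup hF (hT M) (v l)
  -- Modulo `cGroup F`, this adds `-m l % q` to the coefficient `m l` of `t F M 0`; the sum is a
  -- multiple of `q`.
  refine ⟨_, _, hM (fun l => (-m l % q).toNat) 0, fun l => ?_⟩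
  have h0 : 0 ≤ -m l % q := Int.emod_nonneg _ (by omega)
  have h1 : -m l % q < q := Int.emod_lt_of_pos _ (by omega)
  have h2 := desc_sub_sub_mem_cGroup (F := F) hF (L := q) (M := M)
    (x := (-m l % q).toNat) (by omega)
  have h3 : (m l + -m l % q) • t F M 0 ∈ cGroup F := by
    have h4 : m l + -m l % q = (-(-m l / q)) * q := by
      have := Int.emod_add_mul_ediv (-m l) q
      linarith
    rw [h4, mul_smul, natCast_zsmul]
    exact zsmul_mem (hqc _) _
  rw [← natCast_zsmul, Int.toNat_of_nonneg h0] at h2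
  convert add_mem (add_mem (hm l) h2) h3 using 1
  rw [add_smul]
  simp only [Pi.zero_apply]
  abel

theorem height_sub_cast {M M' : ℕ} (h : M ≤ M') :
    ((height F M' - height F M : ℕ) : ℤ) = (height F M' : ℤ) - height F M :=
  Nat.cast_sub ((height_strictMono F).monotone h)

/-- Some products of levels whose address differences are `v` up to a common number of iterations
of the transformation meet. -/
def MeetsUpTo (F : ℕ → CutOp G) (A B : Set (Fin d → ℝ × G)) (k : Fin d → ℤ)
    (v : Fin d → ℤ × G) : Prop :=
  ∃ N n : ℕ, Meets F A B N fun l => v l + (k l * n, 0)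

/-- The two refinements move by `-(x j - y j)` and `x j - y j` copies, where `x j - y j = ρ * k j`.
In coordinates other than `l` only the height term remains. In coordinate `l` the starting indices
differ by one copy, and the change is the difference of one step from `x l + p` and one from `y l +
p`, up to sign. -/
theorem MeetsUpTo.add_single (hF : Recurrent F) (hA : MeasurableSet A) (hB : MeasurableSet B)
    {k : Fin d → ℤ} {v : Fin d → ℤ × G} (h : MeetsUpTo F A B k v) (l : Fin d) (m p ρ : ℕ)
    {ε ε' : ℕ} (hε : ε ≤ 1) (hε' : ε' ≤ 1) (hne : ε ≠ ε') :
    MeetsUpTo F A B k (v + Pi.single l (((ε : ℤ) - ε') •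
      (step F m ((ρ * k l).toNat + p) - step F m ((-(ρ * k l)).toNat + p)))) := by
  obtain ⟨N, n, h⟩ := h
  set L := ∑ j, (ρ * k j).natAbs + p + 4 with hL
  have hLj : ∀ j, (ρ * k j).natAbs + p + 4 ≤ L := fun j => by
    have := Finset.single_le_sum (f := fun j => (ρ * k j).natAbs) (fun _ _ => Nat.zero_le _)
      (Finset.mem_univ j)
    omega
  let x : Fin d → ℕ := fun j => (ρ * k j).toNat
  let y : Fin d → ℕ := fun j => (-(ρ * k j)).toNat
  let a : Fin d → ℕ := fun j => if j = l then p + ε' else 0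
  let b : Fin d → ℕ := fun j => if j = l then p + ε else 0
  have hx : ∀ j, x j + p + 4 ≤ L := fun j => by have := hLj j; simp only [x]; omega
  have hy : ∀ j, y j + p + 4 ≤ L := fun j => by have := hLj j; simp only [y]; omega
  have ha : ∀ j, a j ≤ p + 1 := fun j => by simp only [a]; split_ifs <;> omega
  have hb : ∀ j, b j ≤ p + 1 := fun j => by simp only [b]; split_ifs <;> omega
  have hxy : ∀ j, (x j : ℤ) - y j = ρ * k j := fun j => by simp only [x, y]; omega
  obtain ⟨M, -, hM, h⟩ := h.refine hF hA hB m L 0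
  -- The bound `M ≤ M'` makes the height difference, hence the added number of iterations, a natural
  -- number.
  obtain ⟨M', hMM', hM', h⟩ := (h (fun j => y j + a j) (fun j => x j + a j)).refine hF hA hB m L M
  refine ⟨M' + L, n + ρ * (height F M' - height F M), ?_⟩
  convert h (fun j => x j + b j) (fun j => y j + b j) using 1
  funext j
  have hx' := hx j
  have hy' := hy j
  have ha' := ha j
  have hb' := hb j
  have key := desc_sub_desc (F := F) (L := L) (M := M) (M' := M') (x := x j + b j) (y := y j + b j)
    (fun i hi => (hM i hi).symm.trans (hM' i hi)) (by omega) (by omega)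
  have hk : (k j * ((n + ρ * (height F M' - height F M) : ℕ) : ℤ), (0 : G)) = (k j * n, 0) +
      ((((x j + b j : ℕ) : ℤ) - ((y j + b j : ℕ) : ℤ)) *
        ((height F M' : ℤ) - height F M), 0) := by
    ext
    · push_cast [height_sub_cast hMM']
      rw [add_sub_add_right_eq_sub, hxy]
      simp only [Prod.fst_add]
      ring
    · simp
  rw [key, hk]
  have hmain : (Pi.single l (((ε : ℤ) - ε') •
      (step F m ((ρ * k l).toNat + p) - step F m ((-(ρ * k l)).toNat + p))) : Fin d → ℤ × G) j =
      (desc F L M (y j + a j) - desc F L M (x j + a j)) +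
      (desc F L M (x j + b j) - desc F L M (y j + b j)) := by
    by_cases hj : j = l
    · subst hj
      have h1 := desc_succ_sub (F := F) (r := L) (M := M) (p := x j + p)
        (by have := lt_pieces F L M; omega)
      have h2 := desc_succ_sub (F := F) (r := L) (M := M) (p := y j + p)
        (by have := lt_pieces F L M; omega)
      rw [← step_congr hM (by omega : x j + p + 1 < L)] at h1
      rw [← step_congr hM (by omega : y j + p + 1 < L)] at h2
      have h3 : step F m (x j + p) - step F m (y j + p) =
          (desc F L M (x j + p + 1) - desc F L M (x j + p)) -
          (desc F L M (y j + p + 1) - desc F L M (y j + p)) := by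
        rw [h1, h2]; abel
      have ha1 : a j = p + ε' := if_pos rfl
      have hb1 : b j = p + ε := if_pos rfl
      rw [Pi.single_eq_same, ha1, hb1]
      change _ • (step F m (x j + p) - step F m (y j + p)) = _
      rw [h3]
      have : (ε = 0 ∧ ε' = 1) ∨ (ε = 1 ∧ ε' = 0) := by omega
      rcases this with ⟨rfl, rfl⟩ | ⟨rfl, rfl⟩
      · simp only [← add_assoc, add_zero, Nat.cast_zero, Nat.cast_one, zero_sub, neg_smul,
          one_smul]
        abel
      · simp only [← add_assoc, add_zero, Nat.cast_zero, Nat.cast_one, sub_zero, one_smul]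
        abel
    · have ha1 : a j = 0 := if_neg hj
      have hb1 : b j = 0 := if_neg hj
      rw [Pi.single_eq_of_ne hj, ha1, hb1]
      abel
  rw [Pi.add_apply, hmain]
  abel

theorem single_mem_translates (hF : Recurrent F) (hA : MeasurableSet A) (hB : MeasurableSet B)
    {k : Fin d → ℤ} (hk : ∀ l, k l ≠ 0) (l : Fin d) {x : ℤ × G} (hx : x ∈ cGroup F) :
    Pi.single l x ∈ translates (MeetsUpTo F A B k) := by
  have h1 : periodGroup F (k l).natAbs ≤
      (translates (MeetsUpTo F A B k)).comap (AddMonoidHom.single (fun _ => ℤ × G) l) := by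
    rw [periodGroup, AddSubgroup.closure_le]
    rintro _ ⟨m, p, K, hK, ⟨ρ, rfl⟩, rfl⟩
    change Pi.single l _ ∈ translates _
    have h2 : Pi.single l (step F m ((ρ * k l).toNat + p) - step F m ((-(ρ * k l)).toNat + p)) ∈
        translates (MeetsUpTo F A B k) := by
      intro v
      refine ⟨fun h => ?_, fun h => ?_⟩
      · have := h.add_single hF hA hB l m p ρ le_rfl zero_le_one one_ne_zero
        simpa only [Nat.cast_zero, Nat.cast_one, sub_zero, one_smul] using this
      · have := h.add_single hF hA hB l m p ρ zero_le_one le_rfl zero_ne_one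
        simpa only [Nat.cast_zero, Nat.cast_one, zero_sub, neg_smul, one_smul, Pi.single_neg,
          ← sub_eq_add_neg] using this
    -- One of the two indices is `p` and the other `p + ρ * |k l|`; the sign of `k l` decides which.
    rcases le_total 0 (k l) with h | h
    · have h3 : (ρ * k l).toNat = (k l).natAbs * ρ := by
        rw [← Int.toNat_natCast ((k l).natAbs * ρ)]
        push_cast
        rw [abs_of_nonneg h, mul_comm]
      have h4 : (-(ρ * k l)).toNat = 0 := Int.toNat_of_nonpos (by
        have : 0 ≤ (ρ : ℤ) * k l := by positivity
        omega)
      rwa [h3, h4, zero_add, add_comm _ p] at h2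
    · have h3 : (-(ρ * k l)).toNat = (k l).natAbs * ρ := by
        rw [← Int.toNat_natCast ((k l).natAbs * ρ)]
        push_cast
        rw [abs_of_nonpos h, neg_mul, mul_comm]
      have h4 : (ρ * k l).toNat = 0 := Int.toNat_of_nonpos
        (mul_nonpos_of_nonneg_of_nonpos (by positivity) h)
      rw [h3, h4, zero_add, add_comm _ p] at h2
      have := neg_mem h2
      rwa [← Pi.single_neg, neg_sub] at this
  exact h1 (cGroup_le_periodGroup hF (Int.natAbs_pos.2 (hk l)) hx)

theorem powerWeaklyMixing_of_conditions [Countable G] (hF : Recurrent F) (h1 : ShiftsGenerate F)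
    (h2 : SpanCondition F) : PowerWeaklyMixing F := by
  intro d k _ hk A B hA hB hA0 hB0
  obtain ⟨N, v, h⟩ := exists_meets F hA hB hA0 hB0
  obtain ⟨N, v, h, hv⟩ := h.exists_mem_cGroup hF hA hB (spanGroup_eq_top hF h1 h2)
  have h3 : MeetsUpTo F A B k v := ⟨N, 0, by
    convert h using 1
    funext l
    ext <;> simp⟩
  have h4 : v ∈ translates (MeetsUpTo F A B k) := by
    rw [← Finset.univ_sum_single v]
    exact sum_mem fun l _ => single_mem_translates hF hA hB hk l (hv l)
  obtain ⟨M, n, h5⟩ := of_mem_translates h4 h3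
  refine ⟨n, Meets.measure_pos (N := M) ?_⟩
  convert h5 using 1
  funext l
  simp

/-- Blocks of a single operation already change the `G`-coordinate by any `g F m i - g F m j`. -/
theorem Meets.exists_snd_eq_zero {A B : Set (Fin 1 → ℝ × G)} (hF : Recurrent F)
    (hA : MeasurableSet A) (hB : MeasurableSet B) (h1 : ShiftsGenerate F) {N : ℕ}
    {v : Fin 1 → ℤ × G} (h : Meets F A B N v) : ∃ N v, Meets F A B N v ∧ (v 0).2 = 0 := by
  have h2 : (v 0).2 ∈ translates fun b : G => ∃ N v, Meets F A B N v ∧ (v 0).2 = b := by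
    have h3 : (v 0).2 ∈ AddSubgroup.closure {x : G | ∃ N i, i < γ F N ∧ x = g F N i - g F N 0} := by
      rw [h1]; trivial
    refine (AddSubgroup.closure_le _).2 ?_ h3
    rintro _ ⟨m, i, hi, rfl⟩ b
    have key : ∀ i j, i < γ F m → j < γ F m → (∃ N v, Meets F A B N v ∧ (v 0).2 = b) →
        ∃ N v, Meets F A B N v ∧ (v 0).2 = b + (g F m i - g F m j) := by
      rintro i j hi hj ⟨N, v, h, rfl⟩
      obtain ⟨M, -, hM, h⟩ := h.refine hF hA hB m 1 0
      have h0 : F m = F M := hM 0 one_pos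
      rw [γ_congr h0] at hi hj
      refine ⟨_, _, h (fun _ => i) (fun _ => j), ?_⟩
      simp [desc, vec, Nat.mod_eq_of_lt hi, Nat.mod_eq_of_lt hj, g_congr h0]
    have h0 := lt_trans one_pos (one_lt_γ F m)
    refine ⟨key i 0 hi h0, ?_⟩
    rw [sub_eq_add_neg b, neg_sub]
    exact key 0 i h0 hi
  exact of_mem_translates h2 ⟨N, v, h, rfl⟩

theorem isErgodic_of_isErgodic_pi [Countable G] (f : ℝ × G → ℝ × G)
    (h : IsErgodic (Measure.pi fun _ : Fin 1 => μ F) fun x i => f (x i)) :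
    IsErgodic (μ F) f := by
  intro A B hA hB hA0 hB0
  have hmp := measurePreserving_funUnique (μ F) (Fin 1)
  have hm : ∀ S, (Measure.pi fun _ : Fin 1 => μ F)
      (MeasurableEquiv.funUnique (Fin 1) (ℝ × G) ⁻¹' S) = μ F S :=
    fun S => hmp.measure_preimage_equiv S
  obtain ⟨i, hi⟩ := h _ _ (MeasurableEquiv.measurable _ hA) (MeasurableEquiv.measurable _ hB)
    (by rwa [hm]) (by rwa [hm])
  refine ⟨i, ?_⟩
  rw [← hm]
  convert hi using 2
  ext x
  simp only [Set.mem_preimage, Set.mem_inter_iff, iterate_pi_apply]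
  rfl

theorem isErgodic_of_shiftsGenerate [Countable G] (hF : Recurrent F) (h1 : ShiftsGenerate F) :
    IsErgodic (μ F) (T F) := by
  refine isErgodic_of_isErgodic_pi _ fun A B hA hB hA0 hB0 => ?_
  obtain ⟨N, v, h⟩ := exists_meets F hA hB hA0 hB0
  obtain ⟨N, v, h, hv⟩ := h.exists_snd_eq_zero hF hA hB h1
  obtain ⟨M, -, hM, h⟩ := h.refine hF hA hB 0 2 0
  -- One copy back in the first block and one forth in the second leave only `height F M' - height F
  -- M`. As `M' ≤ height F M'`, this lower bound on `M'` makes the total time nonnegative.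
  obtain ⟨M', hMM', hM', h⟩ := (h (fun _ => 0) (fun _ => 1)).refine hF hA hB 0 2
    ((v 0).1.natAbs + height F M)
  have h2 : M' ≤ height F M' := (height_strictMono F).le_apply
  have h3 := desc_sub_desc (F := F) (L := 2) (M := M) (M' := M') (x := 1) (y := 0)
    (fun i hi => (hM i hi).symm.trans (hM' i hi)) one_lt_two two_pos
  have h4 := h (fun _ => 1) (fun _ => 0)
  refine ⟨((v 0).1 + height F M' - height F M).toNat,
    Meets.measure_pos (k := fun _ => 1) (N := M' + 2) ?_⟩
  convert h4 using 1
  funext l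
  obtain rfl : l = 0 := Subsingleton.elim _ _
  rw [h3, Int.toNat_of_nonneg (by omega)]
  ext
  · simp only [Prod.fst_add, Prod.fst_sub]; push_cast; ring
  · simp [hv]

theorem totallyErgodic_of_powerWeaklyMixing [Countable G] (h : PowerWeaklyMixing F) :
    TotallyErgodic F := fun n hn =>
  isErgodic_of_isErgodic_pi _ (h 1 (fun _ => (n : ℤ)) one_pos fun _ => by simpa using hn.ne')

end Sufficiency

end CutStack

end

theorem mainTheorem1 {G : Type*} [AddCommGroup G] [Countable G] [MeasurableSpace G]
    [DiscreteMeasurableSpace G] (F : ℕ → CutOp G) (hF : CutStack.Recurrent F) :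
    (CutStack.PowerWeaklyMixing F ↔ CutStack.ShiftsGenerate F ∧ CutStack.SpanCondition F) ∧
    (CutStack.PowerWeaklyMixing F ↔ CutStack.TotallyErgodic F) ∧
    (CutStack.IsErgodic (CutStack.μ F) (CutStack.T F) ↔ CutStack.ShiftsGenerate F) := by
  have h1 : CutStack.TotallyErgodic F → CutStack.ShiftsGenerate F ∧ CutStack.SpanCondition F :=
    fun h => ⟨CutStack.shiftsGenerate_of_isErgodic (h 1 one_pos),
      CutStack.spanCondition_of_totallyErgodic h⟩
  have h2 : CutStack.ShiftsGenerate F ∧ CutStack.SpanCondition F → CutStack.PowerWeaklyMixing F :=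
    fun h => CutStack.powerWeaklyMixing_of_conditions hF h.1 h.2
  have h3 : CutStack.PowerWeaklyMixing F → CutStack.TotallyErgodic F :=
    CutStack.totallyErgodic_of_powerWeaklyMixing
  exact ⟨⟨fun h => h1 (h3 h), h2⟩, ⟨h3, fun h => h2 (h1 h)⟩,
    CutStack.shiftsGenerate_of_isErgodic, CutStack.isErgodic_of_shiftsGenerate hF⟩
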